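/- Let $N\ge 1$, $s\in(0,1)$, and let $\Omega\subseteq\mathbb{R}^N$ be a bounded open set (no regularity of $\partial\Omega$ is required). Consider $\mathcal{L}=-\Delta+(-\Delta)^s$ with $$c_{N,s}=\Big(\int_{\mathbb{R}^N}\frac{1-\cos\zeta_1}{|\zeta|^{N+2s}}\,d\zeta\Big)^{-1}.$$ For real-valued $f\in L^2(\Omega)$, a function $u\in H^1(\mathbb{R}^N)$ is called a weak solution of $\mathcal{L}u=f$ in $\Omega$ if $$\int_\Omega\langle\nabla u,\nabla\varphi\rangle\,dx+\frac{c_{N,s}}{2}\int_{\mathbb{R}^N\times\mathbb{R}^N}\frac{(u(x)-u(y))(\varphi(x)-\varphi(y))}{|x-y|^{N+2s}}\,dx\,dy=\int_\Omega f\varphi\,dx\qquad\text{for all }\varphi\in C_0^\infty(\Omega,\mathbb{R}).$$ Then the following holds. 1. If $f\in L^2(\Omega)$ and $u\in H^1(\mathbb{R}^N)$ is a weak solution of $\mathcal{L}u=f$ in $\Omega$, then $u\in H^2_{\mathrm{loc}}(\Omega)$. 2. For every open set $V$ with $\overline V\subseteq\Omega$ there is a constant $\Lambda>0$, independent of $u$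 and $f$, such that for every $f\in L^2(\Omega)$ and every weak solution $u\in H^1(\mathbb{R}^N)$ of $\mathcal{L}u=f$ in $\Omega$ one has $u\in H^2(V)$ and $$\|u\|_{H^2(V)}\le\Lambda\big(\|f\|_{L^2(\Omega)}+\|u\|_{H^1(\mathbb{R}^N)}\big).$$ Here $\|u\|_{H^m(U)}^2=\sum_{k\le m}\sum_{i_1,\dots,i_k=1}^N\|\partial_{i_k}\cdots\partial_{i_1}u\|_{L^2(U)}^2$ (weak derivatives on $U$). -/

import Mathlib

open MeasureTheory Set
open scoped ContDiff

noncomputable section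

namespace MixedLaplacian

/-- The Euclidean space `ℝ^N`. -/
abbrev E (N : ℕ) : Type := EuclideanSpace ℝ (Fin N)

variable {N : ℕ}

/-- `φ ∈ C_0^∞(U, ℝ)`: smooth on `ℝ^N`, with compact support contained in `U`. -/
def IsTestFunction (U : Set (E N)) (φ : E N → ℝ) : Prop :=
  ContDiff ℝ ∞ φ ∧ HasCompactSupport φ ∧ tsupport φ ⊆ U

/-- The classical partial derivative `∂_i φ`. -/
def classicalPartial (i : Fin N) (φ : E N → ℝ) (x : E N) : ℝ :=
  fderiv ℝ φ x (EuclideanSpace.single i 1)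

/-- `g` is a weak partial derivative `∂_i u` on the open set `U`. -/
def IsWeakPartial (U : Set (E N)) (i : Fin N) (u g : E N → ℝ) : Prop :=
  LocallyIntegrableOn u U volume ∧ LocallyIntegrableOn g U volume ∧
    ∀ φ : E N → ℝ, IsTestFunction U φ →
      ∫ x in U, u x * classicalPartial i φ x = -∫ x in U, g x * φ x

/-- Weak partial derivatives on an open set are unique up to null sets. -/
theorem IsWeakPartial.ae_eq {U : Set (E N)} (hU : IsOpen U) {i : Fin N} {u g g' : E N → ℝ}
    (h : IsWeakPartial U i u g) (h' : IsWeakPartial U i u g') :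
    g =ᵐ[volume.restrict U] g' := by
  have key : ∀ᵐ x, x ∈ U → (g - g') x = 0 := by
    refine hU.ae_eq_zero_of_integral_contDiff_smul_eq_zero (h.2.1.sub h'.2.1) ?_
    intro φ hφ hc hs
    have e := (h.2.2 φ ⟨hφ, hc, hs⟩).symm.trans (h'.2.2 φ ⟨hφ, hc, hs⟩)
    have int : ∀ k : E N → ℝ, LocallyIntegrableOn k U volume →
        Integrable (fun x => φ x * k x) := by
      intro k hk
      have h1 : IntegrableOn k (tsupport φ) := hk.integrableOn_compact_subset hs hc
      have h2 : IntegrableOn (fun x => φ x • k x) (tsupport φ) :=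
        h1.continuousOn_smul hφ.continuous.continuousOn hc
      refine (integrableOn_iff_integrable_of_support_subset ?_).1 h2
      intro x hx
      exact subset_tsupport φ (fun h0 => hx (by simp [h0]))
    have conv : ∀ k : E N → ℝ, ∫ x in U, k x * φ x = ∫ x, φ x * k x := by
      intro k
      rw [setIntegral_eq_integral_of_forall_compl_eq_zero]
      · simp only [mul_comm]
      · intro x hx
        have : φ x = 0 := image_eq_zero_of_notMem_tsupport (fun h0 => hx (hs h0))
        simp [this]
    rw [conv, conv] at e
    have : (fun x => φ x • (g - g') x) = fun x => φ x * g x - φ x * g' x := by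
      ext x; simp [mul_sub]
    rw [this, integral_sub (int _ h.2.1) (int _ h'.2.1)]
    linarith
  rw [Filter.EventuallyEq, ae_restrict_iff' hU.measurableSet]
  filter_upwards [key] with x hx hxU
  have := hx hxU
  simp only [Pi.sub_apply] at this
  linarith

open Classical in
/-- The weak partial derivative `∂_i u` on `U` (any representative; `0` if there is none). -/
def weakPartial (U : Set (E N)) (i : Fin N) (u : E N → ℝ) : E N → ℝ :=
  if h : ∃ g, IsWeakPartial U i u g then h.choose else 0

/-- `u ∈ H^m(U)`: all weak partial derivatives of `u` on `U` of order at most `m` exist and lie in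
`L²(U)`. Only the values of `u` on `U` matter. -/
def MemH : ℕ → Set (E N) → (E N → ℝ) → Prop
  | 0, U, u => MemLp u 2 (volume.restrict U)
  | m + 1, U, u => MemLp u 2 (volume.restrict U) ∧
      ∀ i : Fin N, ∃ g, IsWeakPartial U i u g ∧ MemH m U g

/-- `u ∈ H^m_loc(U)`: `u ∈ H^m(V)` for every open `V` compactly contained in `U`. -/
def MemHloc (m : ℕ) (U : Set (E N)) (u : E N → ℝ) : Prop :=
  ∀ V : Set (E N), IsOpen V → IsCompact (closure V) → closure V ⊆ U → MemH m V u

/-- The norm of `L²(U)` (meaningful for `u ∈ L²(U)`). -/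
def normL2 (U : Set (E N)) (u : E N → ℝ) : ℝ :=
  (eLpNorm u 2 (volume.restrict U)).toReal

/-- The square of the `H^m(U)` norm: the sum, over all `k ≤ m` and all `i_1, …, i_k`, of the
squared `L²(U)` norms of `∂_{i_k} ⋯ ∂_{i_1} u` (meaningful for `u ∈ H^m(U)`). -/
def normSqH : ℕ → Set (E N) → (E N → ℝ) → ℝ
  | 0, U, u => normL2 U u ^ 2
  | m + 1, U, u => normL2 U u ^ 2 + ∑ i : Fin N, normSqH m U (weakPartial U i u)

/-- The norm of `H^m(U)`. -/
def normH (m : ℕ) (U : Set (E N)) (u : E N → ℝ) : ℝ :=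
  Real.sqrt (normSqH m U u)

/-- The normalizing constant `c_{N,s}` of the fractional Laplacian `(-Δ)^s` on `ℝ^N`, `N ≥ 1`. -/
def fracConst (N : ℕ) [NeZero N] (s : ℝ) : ℝ :=
  (∫ ζ : E N, (1 - Real.cos (ζ 0)) / ‖ζ‖ ^ ((N : ℝ) + 2 * s))⁻¹

/-- `u ∈ H^1(ℝ^N)` is a weak solution of `-Δu + (-Δ)^s u = f` in `Ω`. -/
def IsWeakSolution [NeZero N] (s : ℝ) (Ω : Set (E N)) (f u : E N → ℝ) : Prop :=
  MemH 1 univ u ∧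
    ∀ φ : E N → ℝ, IsTestFunction Ω φ →
      (∫ x in Ω, ∑ i : Fin N, weakPartial univ i u x * classicalPartial i φ x) +
        fracConst N s / 2 *
          (∫ p : E N × E N,
            (u p.1 - u p.2) * (φ p.1 - φ p.2) / ‖p.1 - p.2‖ ^ ((N : ℝ) + 2 * s)) =
      ∫ x in Ω, f x * φ x

end MixedLaplacian

end

/-!
Interior `H²` regularity for `-Δ + (-Δ)^s`, by localization and an energy estimate.

Let `η` be a cutoff function in `Ω`, equal to one on `V`, and let `v = η u`. Testing the equation of
`u` with `η φ` shows that `v` solves the same equation on the whole space, up to commutator terms,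
all bounded by a constant times `‖φ‖_{L²}` (`exists_localized_bound`). For the local part these are
`2 ∇η · ∇u` and `u Δη`. For the nonlocal part the double integral is written as an integral over
the increment `h = y - x` of the pairing `shiftForm` of the increments of `u` and `φ`. For fixed
`h` there is no singularity, translations are isometries of `L²`, and a change of variables puts the
commutator in a form in which `φ` is not differenced, while either `η` and `u` are differenced once
each or `η` is differenced twice (`abs_shiftForm_commutator_le`). As
`‖u(· + h) - u‖_{L²} ≤ |h| ∑ ‖∂_i u‖_{L²}` (`l2_translate_sub_le`), the commutator at `h` is
`O(min(1, |h|²))`, which is integrable against `|h|^{-N-2s}`; this also gives the absolute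
convergence of the double integral (`integral_prod_eq_nonlocalForm`).

On the whole space (`exists_second_weakPartial`), both forms commute with convolution by an even
mollifier, so that the mollification of `v` satisfies the same bound. It is a test function, and may
be tested with its own second derivative `∂_i ∂_i`. The nonlocal form then contributes
`-⟨∂_i v, ∂_i v⟩`, which has the sign of the local part and can be dropped, whence an `L²` bound on
all second derivatives (`l2_second_partial_le`). It passes to `v` by duality with test functions,
and the Riesz representation theorem provides the weak second derivatives
(`exists_memLp_of_bound`).
-/

noncomputable section

namespace MixedLaplacian

/-! ### The space `L²` -/

section General

variable {α : Type*} [MeasurableSpace α] {μ : Measure α} {f g : α → ℝ}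

theorem integrable_mul_of_memLp_two (hf : MemLp f 2 μ) (hg : MemLp g 2 μ) :
    Integrable (fun x => f x * g x) μ :=
  MemLp.integrable_mul hf hg

theorem integral_mul_self_eq (hf : MemLp f 2 μ) :
    ∫ x, f x * f x ∂μ = (eLpNorm f 2 μ).toReal ^ 2 := by
  have h := real_inner_self_eq_norm_sq (hf.toLp f)
  rw [L2.inner_def, Lp.norm_toLp] at h
  rw [← h]
  refine integral_congr_ae ?_
  filter_upwards [hf.coeFn_toLp] with x hx
  simp [hx, sq]

theorem abs_integral_mul_le (hf : MemLp f 2 μ) (hg : MemLp g 2 μ) :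
    |∫ x, f x * g x ∂μ| ≤ (eLpNorm f 2 μ).toReal * (eLpNorm g 2 μ).toReal := by
  have h := abs_real_inner_le_norm (hf.toLp f) (hg.toLp g)
  rw [L2.inner_def, Lp.norm_toLp, Lp.norm_toLp] at h
  refine le_trans (le_of_eq ?_) h
  congr 1
  refine integral_congr_ae ?_
  filter_upwards [hf.coeFn_toLp, hg.coeFn_toLp] with x hx hy
  simp [hx, hy, mul_comm]

theorem integral_abs_mul_le (hf : MemLp f 2 μ) (hg : MemLp g 2 μ) :
    ∫ x, |f x * g x| ∂μ ≤ (eLpNorm f 2 μ).toReal * (eLpNorm g 2 μ).toReal := by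
  have h := abs_integral_mul_le hf.norm hg.norm
  rw [eLpNorm_norm, eLpNorm_norm] at h
  simp only [Real.norm_eq_abs, ← abs_mul] at h
  exact (le_abs_self _).trans h

end General

variable {N : ℕ}

/-- The norm of `L²(ℝ^N)` (meaningful for `f ∈ L²(ℝ^N)`). -/
def l2 (f : E N → ℝ) : ℝ := (eLpNorm f 2 volume).toReal

theorem normL2_univ (f : E N → ℝ) : normL2 univ f = l2 f := by
  simp [normL2, l2]

theorem l2_nonneg (f : E N → ℝ) : 0 ≤ l2 f := ENNReal.toReal_nonneg

theorem normL2_nonneg (U : Set (E N)) (f : E N → ℝ) : 0 ≤ normL2 U f := ENNReal.toReal_nonneg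

theorem normL2_le_l2 {f : E N → ℝ} (hf : MemLp f 2 volume) (U : Set (E N)) :
    normL2 U f ≤ l2 f :=
  ENNReal.toReal_mono hf.eLpNorm_ne_top (eLpNorm_mono_measure _ Measure.restrict_le_self)

theorem l2_sub_le {f g : E N → ℝ} (hf : MemLp f 2 volume) (hg : MemLp g 2 volume) :
    l2 (fun x => f x - g x) ≤ l2 f + l2 g := by
  unfold l2
  rw [← ENNReal.toReal_add hf.eLpNorm_ne_top hg.eLpNorm_ne_top]
  exact ENNReal.toReal_mono (ENNReal.add_ne_top.2 ⟨hf.eLpNorm_ne_top, hg.eLpNorm_ne_top⟩)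
    (eLpNorm_sub_le hf.1 hg.1 (by norm_num))

theorem memLp_bdd_mul {η f : E N → ℝ} {μ : Measure (E N)} {C : ℝ} (hη : Continuous η)
    (hC : ∀ x, |η x| ≤ C) (hf : MemLp f 2 μ) : MemLp (fun x => η x * f x) 2 μ := by
  refine MemLp.of_le_mul (c := C) hf (hη.aestronglyMeasurable.mul hf.1) ?_
  filter_upwards with x
  rw [norm_mul]
  exact mul_le_mul_of_nonneg_right (hC x) (norm_nonneg _)

theorem l2_bdd_mul_le {η f : E N → ℝ} {C : ℝ} (hC : ∀ x, |η x| ≤ C) (hf : MemLp f 2 volume) :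
    l2 (fun x => η x * f x) ≤ C * l2 f := by
  have hC0 : 0 ≤ C := (abs_nonneg _).trans (hC 0)
  have h : eLpNorm (fun x => η x * f x) 2 volume ≤ ENNReal.ofReal C * eLpNorm f 2 volume := by
    refine eLpNorm_le_mul_eLpNorm_of_ae_le_mul ?_ 2
    filter_upwards with x
    rw [norm_mul]
    exact mul_le_mul_of_nonneg_right (hC x) (norm_nonneg _)
  unfold l2
  refine (ENNReal.toReal_mono (ENNReal.mul_ne_top ENNReal.ofReal_ne_top hf.eLpNorm_ne_top) h).trans
    (le_of_eq ?_)
  rw [ENNReal.toReal_mul, ENNReal.toReal_ofReal hC0]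

theorem memLp_translate {f : E N → ℝ} (hf : MemLp f 2 volume) (h : E N) :
    MemLp (fun x => f (x + h)) 2 volume :=
  hf.comp_measurePreserving (measurePreserving_add_right volume h)

theorem l2_translate {f : E N → ℝ} (hf : MemLp f 2 volume) (h : E N) :
    l2 (fun x => f (x + h)) = l2 f := by
  unfold l2
  congr 1
  exact eLpNorm_comp_measurePreserving hf.1 (measurePreserving_add_right volume h)

/-! ### Test functions -/

theorem isTestFunction_univ {φ : E N → ℝ} :
    IsTestFunction univ φ ↔ ContDiff ℝ ∞ φ ∧ HasCompactSupport φ := by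
  simp [IsTestFunction]

namespace IsTestFunction

variable {U : Set (E N)} {φ ψ : E N → ℝ}

theorem of_subset {W : Set (E N)} (hφ : IsTestFunction U φ) (h : U ⊆ W) : IsTestFunction W φ :=
  ⟨hφ.1, hφ.2.1, hφ.2.2.trans h⟩

theorem toUniv (hφ : IsTestFunction U φ) : IsTestFunction univ φ := hφ.of_subset (subset_univ U)

theorem continuous (hφ : IsTestFunction U φ) : Continuous φ := hφ.1.continuous

theorem differentiable (hφ : IsTestFunction U φ) : Differentiable ℝ φ :=
  hφ.1.differentiable (by simp)

theorem memLp (hφ : IsTestFunction U φ) : MemLp φ 2 volume :=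
  hφ.continuous.memLp_of_hasCompactSupport hφ.2.1

theorem integrable (hφ : IsTestFunction U φ) : Integrable φ volume :=
  hφ.continuous.integrable_of_hasCompactSupport hφ.2.1

theorem exists_bound (hφ : IsTestFunction U φ) : ∃ C : ℝ, 0 ≤ C ∧ ∀ x, |φ x| ≤ C := by
  obtain ⟨C, hC⟩ := hφ.2.1.exists_bound_of_continuous hφ.continuous
  exact ⟨C, (norm_nonneg _).trans (hC 0), hC⟩

theorem eq_zero (hφ : IsTestFunction U φ) {x : E N} (hx : x ∉ U) : φ x = 0 :=
  image_eq_zero_of_notMem_tsupport fun h => hx (hφ.2.2 h)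

theorem partial_deriv (hφ : IsTestFunction U φ) (i : Fin N) :
    IsTestFunction U (classicalPartial i φ) := by
  refine ⟨?_, hφ.2.1.fderiv_apply (𝕜 := ℝ) _, (tsupport_fderiv_apply_subset ℝ _).trans hφ.2.2⟩
  exact (hφ.1.fderiv_right (m := ∞) (by simp)).clm_apply contDiff_const

theorem mul_smooth (hφ : IsTestFunction U φ) (hψ : ContDiff ℝ ∞ ψ) :
    IsTestFunction U (fun x => φ x * ψ x) :=
  ⟨hφ.1.mul hψ, hφ.2.1.mul_right, (tsupport_mul_subset_left).trans hφ.2.2⟩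

theorem smul (hφ : IsTestFunction U φ) (c : ℝ) : IsTestFunction U (fun x => c * φ x) := by
  have := hφ.mul_smooth (ψ := fun _ => c) contDiff_const
  simpa only [mul_comm] using this

theorem add (hφ : IsTestFunction U φ) (hψ : IsTestFunction U ψ) :
    IsTestFunction U (fun x => φ x + ψ x) :=
  ⟨hφ.1.add hψ.1, hφ.2.1.add hψ.2.1,
    (tsupport_add φ ψ).trans (union_subset hφ.2.2 hψ.2.2)⟩

theorem neg (hφ : IsTestFunction U φ) : IsTestFunction U (fun x => -φ x) := by
  simpa using hφ.smul (-1)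

theorem sub (hφ : IsTestFunction U φ) (hψ : IsTestFunction U ψ) :
    IsTestFunction U (fun x => φ x - ψ x) := by
  simpa [sub_eq_add_neg] using hφ.add hψ.neg

theorem translate (hφ : IsTestFunction univ φ) (h : E N) :
    IsTestFunction univ (fun x => φ (x + h)) :=
  isTestFunction_univ.2 ⟨hφ.1.comp (contDiff_id.add contDiff_const),
    hφ.2.1.comp_homeomorph (Homeomorph.addRight h)⟩

/-- The reflection `x ↦ φ (z - x)` of a test function. -/
theorem reflect (hφ : IsTestFunction univ φ) (z : E N) :
    IsTestFunction univ (fun x => φ (z - x)) :=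
  isTestFunction_univ.2 ⟨hφ.1.comp (contDiff_const.sub contDiff_id),
    hφ.2.1.comp_homeomorph (Homeomorph.subLeft z)⟩

end IsTestFunction

theorem classicalPartial_mul {φ ψ : E N → ℝ} (hφ : Differentiable ℝ φ) (hψ : Differentiable ℝ ψ)
    (i : Fin N) (x : E N) :
    classicalPartial i (fun x => φ x * ψ x) x =
      classicalPartial i φ x * ψ x + φ x * classicalPartial i ψ x := by
  unfold classicalPartial
  rw [fderiv_fun_mul (hφ x) (hψ x)]
  simp
  ring

theorem classicalPartial_add {φ ψ : E N → ℝ} (hφ : Differentiable ℝ φ) (hψ : Differentiable ℝ ψ)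
    (i : Fin N) (x : E N) :
    classicalPartial i (fun x => φ x + ψ x) x =
      classicalPartial i φ x + classicalPartial i ψ x := by
  unfold classicalPartial
  rw [fderiv_fun_add (hφ x) (hψ x)]
  simp

theorem classicalPartial_const_mul {φ : E N → ℝ} (hφ : Differentiable ℝ φ) (c : ℝ)
    (i : Fin N) (x : E N) :
    classicalPartial i (fun x => c * φ x) x = c * classicalPartial i φ x := by
  unfold classicalPartial
  rw [fderiv_const_mul (hφ x)]
  simp

theorem classicalPartial_sub {φ ψ : E N → ℝ} (hφ : Differentiable ℝ φ) (hψ : Differentiable ℝ ψ)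
    (i : Fin N) (x : E N) :
    classicalPartial i (fun x => φ x - ψ x) x =
      classicalPartial i φ x - classicalPartial i ψ x := by
  unfold classicalPartial
  rw [fderiv_fun_sub (hφ x) (hψ x)]
  simp

theorem classicalPartial_translate (φ : E N → ℝ) (h : E N) (i : Fin N) (x : E N) :
    classicalPartial i (fun x => φ (x + h)) x = classicalPartial i φ (x + h) := by
  unfold classicalPartial
  rw [fderiv_comp_add_right]

theorem classicalPartial_reflect {φ : E N → ℝ} (hφ : Differentiable ℝ φ) (z : E N) (i : Fin N) (x : E N) :
    classicalPartial i (fun x => φ (z - x)) x = -classicalPartial i φ (z - x) := by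
  unfold classicalPartial
  have h : HasFDerivAt (fun y => φ (z - y))
      ((fderiv ℝ φ (z - x)).comp (-ContinuousLinearMap.id ℝ (E N))) x :=
    (hφ (z - x)).hasFDerivAt.comp x ((hasFDerivAt_id x).const_sub z)
  rw [h.fderiv]
  simp

/-- Integration by parts for test functions. -/
theorem integral_mul_classicalPartial {φ ψ : E N → ℝ} (hφ : IsTestFunction univ φ)
    (hψ : IsTestFunction univ ψ) (i : Fin N) :
    ∫ x, φ x * classicalPartial i ψ x = -∫ x, classicalPartial i φ x * ψ x := by
  refine integral_mul_fderiv_eq_neg_fderiv_mul_of_integrable ?_ ?_ ?_ ?_ ?_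
  · exact integrable_mul_of_memLp_two (hφ.partial_deriv i).memLp hψ.memLp
  · exact integrable_mul_of_memLp_two hφ.memLp (hψ.partial_deriv i).memLp
  · exact integrable_mul_of_memLp_two hφ.memLp hψ.memLp
  · exact fun x _ => hφ.differentiable x
  · exact fun x _ => hψ.differentiable x

theorem classicalPartial_comm {U : Set (E N)} {φ : E N → ℝ} (hφ : IsTestFunction U φ)
    (i j : Fin N) (x : E N) :
    classicalPartial i (classicalPartial j φ) x = classicalPartial j (classicalPartial i φ) x := by
  have hd : DifferentiableAt ℝ (fderiv ℝ φ) x :=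
    ((hφ.1.fderiv_right (m := ∞) (by simp)).differentiable (by simp)) x
  have key : ∀ k l : Fin N, classicalPartial k (classicalPartial l φ) x =
      fderiv ℝ (fderiv ℝ φ) x (EuclideanSpace.single k 1) (EuclideanSpace.single l 1) := by
    intro k l
    unfold classicalPartial
    rw [fderiv_clm_apply hd (differentiableAt_const _)]
    simp
  rw [key, key]
  have hsymm : IsSymmSndFDerivAt ℝ φ x :=
    hφ.1.contDiffAt.isSymmSndFDerivAt (by simpa using (mod_cast le_top : ((2 : ℕ∞) : WithTop ℕ∞) ≤ ∞))
  exact hsymm _ _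

/-- A linear functional on test functions that is bounded by `C` in the `L²` norm is represented by
a function of `L²` norm at most `C`: it extends to `L²` by density, and the Riesz representation
applies. -/
theorem exists_memLp_of_bound {L : (E N → ℝ) → ℝ} {C : ℝ} (hC0 : 0 ≤ C)
    (hadd : ∀ φ ψ, IsTestFunction univ φ → IsTestFunction univ ψ →
      L (fun x => φ x + ψ x) = L φ + L ψ)
    (hsmul : ∀ (c : ℝ) φ, IsTestFunction univ φ → L (fun x => c * φ x) = c * L φ)
    (hL : ∀ φ, IsTestFunction univ φ → |L φ| ≤ C * l2 φ) :
    ∃ g : E N → ℝ, MemLp g 2 volume ∧ l2 g ≤ C ∧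
      ∀ φ, IsTestFunction univ φ → L φ = ∫ x, g x * φ x := by
  let T : Submodule ℝ (E N → ℝ) :=
    { carrier := {φ | IsTestFunction univ φ}
      add_mem' := fun ha hb => ha.add hb
      zero_mem' := isTestFunction_univ.2 ⟨contDiff_const, HasCompactSupport.zero⟩
      smul_mem' := fun c _ ha => ha.smul c }
  -- the inclusion of the test functions into `L²`
  let ι : T →ₗ[ℝ] Lp ℝ 2 (volume : Measure (E N)) :=
    { toFun := fun φ => (IsTestFunction.memLp φ.2).toLp φ.1
      map_add' := fun φ ψ => MemLp.toLp_add (IsTestFunction.memLp φ.2) (IsTestFunction.memLp ψ.2)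
      map_smul' := fun c φ => MemLp.toLp_const_smul c (IsTestFunction.memLp φ.2) }
  let ℓ : T →ₗ[ℝ] ℝ :=
    { toFun := fun φ => L φ.1
      map_add' := fun φ ψ => hadd _ _ φ.2 ψ.2
      map_smul' := fun c φ => hsmul c _ φ.2 }
  have hnorm : ∀ φ : T, ‖ι φ‖ = l2 φ.1 := fun φ =>
    Lp.norm_toLp φ.1 (IsTestFunction.memLp φ.2)
  have hdense : DenseRange ι := by
    refine (Lp.dense_hasCompactSupport_contDiff (F := ℝ) (p := 2) (μ := (volume : Measure (E N)))
      (by simp)).mono ?_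
    rintro f ⟨g, hfg, hg1, hg2⟩
    have hg : IsTestFunction univ g := isTestFunction_univ.2 ⟨hg2, hg1⟩
    refine ⟨⟨g, hg⟩, Lp.ext ?_⟩
    exact (MemLp.coeFn_toLp hg.memLp).trans hfg.symm
  have hbd : ∀ φ : T, ‖ℓ φ‖ ≤ C * ‖ι φ‖ := fun φ => by
    rw [hnorm]
    exact hL φ.1 φ.2
  let G : Lp ℝ 2 (volume : Measure (E N)) :=
    (InnerProductSpace.toDual ℝ _).symm (ℓ.extendOfNorm ι)
  refine ⟨G, Lp.memLp G, ?_, fun φ hφ => ?_⟩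
  · have : l2 G = ‖G‖ := (Lp.norm_def G).symm
    rw [this, LinearIsometryEquiv.norm_map]
    exact LinearMap.opNorm_extendOfNorm_le hdense hC0 hbd
  · have h1 : ℓ.extendOfNorm ι (ι ⟨φ, hφ⟩) = L φ :=
      LinearMap.extendOfNorm_eq hdense ⟨C, hbd⟩ ⟨φ, hφ⟩
    rw [← h1, ← InnerProductSpace.toDual_symm_apply, L2.inner_def]
    refine integral_congr_ae ?_
    filter_upwards [MemLp.coeFn_toLp hφ.memLp] with x hx
    have hx' : (ι ⟨φ, hφ⟩ : E N → ℝ) x = φ x := hx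
    rw [hx']
    exact mul_comm _ _

/-- The `L²` norm is determined by duality with test functions. -/
theorem l2_le_of_forall_test {g : E N → ℝ} {C : ℝ} (hg : MemLp g 2 volume) (hC0 : 0 ≤ C)
    (h : ∀ φ, IsTestFunction univ φ → |∫ x, g x * φ x| ≤ C * l2 φ) : l2 g ≤ C := by
  obtain ⟨g', hg', hle, heq⟩ := exists_memLp_of_bound (L := fun φ => ∫ x, g x * φ x) hC0
    (fun φ ψ hφ hψ => by
      simp only [mul_add]
      exact integral_add (integrable_mul_of_memLp_two hg hφ.memLp)
        (integrable_mul_of_memLp_two hg hψ.memLp))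
    (fun c φ _ => by
      simp only [mul_left_comm]
      exact integral_const_mul _ _) h
  have hae : g =ᵐ[volume] g' := by
    refine ae_eq_of_integral_contDiff_smul_eq (hg.locallyIntegrable (by norm_num))
      (hg'.locallyIntegrable (by norm_num)) fun φ hφ hc => ?_
    have := heq φ (isTestFunction_univ.2 ⟨hφ, hc⟩)
    simpa only [smul_eq_mul, mul_comm] using this
  have : l2 g = l2 g' := by
    unfold l2
    rw [eLpNorm_congr_ae hae]
  rw [this]
  exact hle

/-! ### Mollification -/

/-- A mollifier: an even nonnegative test function of integral one. -/
structure IsMollifier (ρ : E N → ℝ) : Prop where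
  test : IsTestFunction univ ρ
  nonneg : ∀ x, 0 ≤ ρ x
  even : ∀ x, ρ (-x) = ρ x
  integral_eq_one : ∫ x, ρ x = 1

/-- The convolution of `u` with the kernel `ρ`. -/
def mollify (ρ u : E N → ℝ) (x : E N) : ℝ := ∫ t, u t * ρ (x - t)

theorem mollify_eq_convolution (ρ u : E N → ℝ) :
    mollify ρ u = convolution u ρ (ContinuousLinearMap.mul ℝ ℝ) volume := rfl

theorem mollify_eq_swap (ρ u : E N → ℝ) (x : E N) : mollify ρ u x = ∫ t, u (x - t) * ρ t := by
  rw [mollify_eq_convolution, convolution_mul_swap]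

theorem contDiff_mollify {ρ u : E N → ℝ} (hρ : IsTestFunction univ ρ)
    (hu : LocallyIntegrable u volume) : ContDiff ℝ ∞ (mollify ρ u) := by
  rw [mollify_eq_convolution]
  exact hρ.2.1.contDiff_convolution_right _ hu hρ.1

theorem isTestFunction_mollify {ρ u : E N → ℝ} (hρ : IsTestFunction univ ρ)
    (hu : LocallyIntegrable u volume) (hc : HasCompactSupport u) :
    IsTestFunction univ (mollify ρ u) := by
  refine isTestFunction_univ.2 ⟨contDiff_mollify hρ hu, ?_⟩
  rw [mollify_eq_convolution]
  exact hc.convolution _ hρ.2.1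

/-- Mollification turns weak partial derivatives into classical ones. -/
theorem classicalPartial_mollify {ρ u g : E N → ℝ} {i : Fin N} (hρ : IsTestFunction univ ρ)
    (hu : IsWeakPartial univ i u g) (x : E N) :
    classicalPartial i (mollify ρ u) x = mollify ρ g x := by
  have hloc : LocallyIntegrable u volume := locallyIntegrableOn_univ.1 hu.1
  have h1 := hρ.2.1.hasFDerivAt_convolution_right (ContinuousLinearMap.mul ℝ ℝ) hloc
    (hρ.1.of_le (by simp)) x
  have h2 : classicalPartial i (mollify ρ u) x =
      ∫ t, u t * classicalPartial i ρ (x - t) := by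
    unfold classicalPartial
    rw [mollify_eq_convolution, h1.fderiv, convolution_precompR_apply _ hloc
      (hρ.2.1.fderiv (𝕜 := ℝ)) (hρ.1.continuous_fderiv (by simp))]
    rfl
  have h3 := hu.2.2 _ (hρ.reflect x)
  simp only [Measure.restrict_univ, classicalPartial_reflect hρ.differentiable, mul_neg,
    integral_neg, neg_inj] at h3
  rw [h2, h3]
  rfl

/-- Convolution with an even kernel is symmetric. -/
theorem integral_mollify_mul {ρ u ψ : E N → ℝ} (hρ : IsTestFunction univ ρ)
    (heven : ∀ x, ρ (-x) = ρ x) (hu : Integrable u volume) (hψ : IsTestFunction univ ψ) :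
    ∫ x, mollify ρ u x * ψ x = ∫ x, u x * mollify ρ ψ x := by
  obtain ⟨C, -, hC⟩ := hψ.exists_bound
  have hint : Integrable (fun p : E N × E N => u p.2 * ρ (p.1 - p.2) * ψ p.1)
      (volume.prod volume) := by
    refine Integrable.mul_bdd (c := C)
      (hu.convolution_integrand (ContinuousLinearMap.mul ℝ ℝ) hρ.integrable)
      (hψ.continuous.comp continuous_fst).aestronglyMeasurable ?_
    exact Filter.Eventually.of_forall fun p => hC p.1
  calc ∫ x, mollify ρ u x * ψ x = ∫ x, ∫ t, u t * ρ (x - t) * ψ x := by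
        simp only [mollify, integral_mul_const]
    _ = ∫ t, ∫ x, u t * ρ (x - t) * ψ x := integral_integral_swap hint
    _ = ∫ x, u x * mollify ρ ψ x := by
        refine integral_congr_ae (Filter.Eventually.of_forall fun t => ?_)
        simp only [mollify]
        rw [← integral_const_mul]
        refine integral_congr_ae (Filter.Eventually.of_forall fun x => ?_)
        simp only
        rw [← heven, neg_sub]
        ring

/-- Convolution with a mollifier does not increase the `L²` norm. -/
theorem l2_mollify_le {ρ φ : E N → ℝ} (hρ : IsMollifier ρ) (hφ : IsTestFunction univ φ) :
    l2 (mollify ρ φ) ≤ l2 φ := by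
  set ψ := mollify ρ φ with hψdef
  have hψ : IsTestFunction univ ψ :=
    isTestFunction_mollify hρ.test hφ.continuous.locallyIntegrable hφ.2.1
  obtain ⟨C, -, hC⟩ := hψ.exists_bound
  have hint : Integrable (fun p : E N × E N => ρ p.2 * φ (p.1 - p.2) * ψ p.1)
      (volume.prod volume) := by
    refine Integrable.mul_bdd (c := C)
      (hρ.test.integrable.convolution_integrand (ContinuousLinearMap.mul ℝ ℝ) hφ.integrable)
      (hψ.continuous.comp continuous_fst).aestronglyMeasurable ?_
    exact Filter.Eventually.of_forall fun p => hC p.1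
  have h1 : ∫ x, ψ x * ψ x = ∫ t, ∫ x, ρ t * φ (x - t) * ψ x := by
    calc ∫ x, ψ x * ψ x = ∫ x, ∫ t, ρ t * φ (x - t) * ψ x := by
          refine integral_congr_ae (Filter.Eventually.of_forall fun x => ?_)
          simp only
          rw [integral_mul_const, hψdef, mollify_eq_swap]
          simp only [mul_comm]
      _ = _ := integral_integral_swap hint
  have h2 : ∫ t, ∫ x, ρ t * φ (x - t) * ψ x ≤ ∫ t, ρ t * (l2 φ * l2 ψ) := by
    refine integral_mono hint.swap.integral_prod_left (hρ.test.integrable.mul_const _) fun t => ?_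
    simp only [mul_assoc]
    rw [integral_const_mul]
    refine mul_le_mul_of_nonneg_left ?_ (hρ.nonneg t)
    have h := abs_integral_mul_le (memLp_translate hφ.memLp (-t)) hψ.memLp
    have h' := l2_translate hφ.memLp (-t)
    simp only [← sub_eq_add_neg] at h h'
    exact (le_abs_self _).trans (h.trans (le_of_eq (congrArg (· * l2 ψ) h')))
  rw [integral_mul_const, hρ.integral_eq_one, one_mul, ← h1, integral_mul_self_eq hψ.memLp] at h2
  change l2 ψ ^ 2 ≤ _ at h2
  rcases (l2_nonneg ψ).eq_or_lt with h0 | h0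
  · rw [← h0]
    exact l2_nonneg φ
  · exact le_of_mul_le_mul_right (by rwa [← sq]) h0

theorem mollify_translate (ρ u : E N → ℝ) (h x : E N) :
    mollify ρ (fun y => u (y + h)) x = mollify ρ u (x + h) := by
  rw [mollify_eq_swap, mollify_eq_swap]
  simp only [sub_add_eq_add_sub]

/-- Test functions are uniformly approximated by their mollifications. -/
theorem exists_isMollifier_dist_le {ψ : E N → ℝ} (hψ : IsTestFunction univ ψ) {ε : ℝ}
    (hε : 0 < ε) : ∃ ρ : E N → ℝ, IsMollifier ρ ∧ ∀ x, |mollify ρ ψ x - ψ x| ≤ ε := by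
  have huc : UniformContinuous ψ := hψ.2.1.uniformContinuous_of_continuous hψ.continuous
  obtain ⟨δ, hδ, H⟩ := Metric.uniformContinuous_iff.1 huc ε hε
  let b : ContDiffBump (0 : E N) := ⟨δ / 2, δ, half_pos hδ, half_lt_self hδ⟩
  refine ⟨b.normed volume, ⟨isTestFunction_univ.2 ⟨b.contDiff_normed, b.hasCompactSupport_normed⟩,
    b.nonneg_normed, b.normed_neg, b.integral_normed⟩, fun x => ?_⟩
  have h := b.dist_normed_convolution_le (μ := volume) (x₀ := x) (ε := ε)
    hψ.continuous.aestronglyMeasurable (fun y hy => (H hy).le)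
  rw [convolution_lsmul_swap, Real.dist_eq] at h
  simpa only [mollify, smul_eq_mul, mul_comm] using h

/-! ### Translations of functions with a weak gradient in `L²` -/

/-- `u ∈ H¹(ℝ^N)` with weak gradient `g`. -/
structure HasWeakGrad (u : E N → ℝ) (g : Fin N → E N → ℝ) : Prop where
  memLp : MemLp u 2 volume
  grad_memLp : ∀ i, MemLp (g i) 2 volume
  weak : ∀ i, IsWeakPartial univ i u (g i)

/-- The size of `u` in `H¹(ℝ^N)`, in the form of a sum of `L²` norms. -/
def gradNorm (u : E N → ℝ) (g : Fin N → E N → ℝ) : ℝ := l2 u + ∑ i, l2 (g i)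

theorem gradNorm_nonneg (u : E N → ℝ) (g : Fin N → E N → ℝ) : 0 ≤ gradNorm u g :=
  add_nonneg (l2_nonneg u) (Finset.sum_nonneg fun i _ => l2_nonneg (g i))

theorem l2_le_gradNorm (u : E N → ℝ) (g : Fin N → E N → ℝ) : l2 u ≤ gradNorm u g :=
  le_add_of_nonneg_right (Finset.sum_nonneg fun i _ => l2_nonneg (g i))

theorem l2_grad_le_gradNorm (u : E N → ℝ) (g : Fin N → E N → ℝ) (i : Fin N) :
    l2 (g i) ≤ gradNorm u g :=
  (Finset.single_le_sum (fun j _ => l2_nonneg (g j)) (Finset.mem_univ i)).trans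
    (le_add_of_nonneg_left (l2_nonneg u))

theorem HasWeakGrad.of_test {φ : E N → ℝ} (hφ : IsTestFunction univ φ) :
    HasWeakGrad φ fun i => classicalPartial i φ where
  memLp := hφ.memLp
  grad_memLp i := (hφ.partial_deriv i).memLp
  weak i := ⟨hφ.continuous.locallyIntegrable.locallyIntegrableOn _,
    (hφ.partial_deriv i).continuous.locallyIntegrable.locallyIntegrableOn _, fun ψ hψ => by
      simpa using integral_mul_classicalPartial hφ hψ i⟩

theorem fderiv_apply_eq_sum (F : E N → ℝ) (z v : E N) :
    fderiv ℝ F z v = ∑ i, v i * classicalPartial i F z := by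
  conv_lhs => rw [← (EuclideanSpace.basisFun (Fin N) ℝ).sum_repr v]
  simp [classicalPartial]

theorem l2_translate_sub_le {u : E N → ℝ} {g : Fin N → E N → ℝ} (hu : HasWeakGrad u g)
    (h : E N) : l2 (fun x => u (x + h) - u x) ≤ ‖h‖ * ∑ i, l2 (g i) := by
  refine l2_le_of_forall_test ((memLp_translate hu.memLp h).sub hu.memLp)
    (mul_nonneg (norm_nonneg _) (Finset.sum_nonneg fun i _ => l2_nonneg (g i))) fun φ hφ => ?_
  -- `F z = ∫ u (t) φ (t - z) dt` has gradient bounded by the `L²` norms of `g` and of `φ`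
  have hρ : IsTestFunction univ (fun y => φ (0 - y)) := hφ.reflect 0
  set F := mollify (fun y => φ (0 - y)) u with hF
  have hFs : ContDiff ℝ ∞ F := contDiff_mollify hρ (hu.memLp.locallyIntegrable (by norm_num))
  have hpart : ∀ i z, |classicalPartial i F z| ≤ l2 (g i) * l2 φ := by
    intro i z
    rw [hF, classicalPartial_mollify hρ (hu.weak i) z]
    have h1 := abs_integral_mul_le (hu.grad_memLp i) (memLp_translate hφ.memLp (-z))
    have h2 := l2_translate hφ.memLp (-z)
    have h3 : mollify (fun y => φ (0 - y)) (g i) z = ∫ t, g i t * φ (t + -z) := by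
      unfold mollify
      refine integral_congr_ae (Filter.Eventually.of_forall fun t => ?_)
      simp only
      congr 2
      abel
    rw [h3]
    exact h1.trans (le_of_eq (congrArg (l2 (g i) * ·) h2))
  have hderiv : ∀ z, ‖fderiv ℝ F z‖ ≤ (∑ i, l2 (g i)) * l2 φ := by
    intro z
    refine ContinuousLinearMap.opNorm_le_bound _
      (mul_nonneg (Finset.sum_nonneg fun i _ => l2_nonneg (g i)) (l2_nonneg φ)) fun v => ?_
    rw [fderiv_apply_eq_sum, Real.norm_eq_abs]
    refine (Finset.abs_sum_le_sum_abs _ _).trans ?_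
    rw [Finset.sum_mul, Finset.sum_mul]
    refine Finset.sum_le_sum fun i _ => ?_
    rw [abs_mul, mul_comm]
    exact mul_le_mul (hpart i z) (PiLp.norm_apply_le v i) (abs_nonneg _)
      (mul_nonneg (l2_nonneg _) (l2_nonneg _))
  have hmv := Convex.norm_image_sub_le_of_norm_fderiv_le (𝕜 := ℝ) (f := F) (s := univ)
    (x := 0) (y := h) (fun z _ => hFs.differentiable (by simp) z) (fun z _ => hderiv z)
    convex_univ (mem_univ _) (mem_univ _)
  have hF0 : F 0 = ∫ x, u x * φ x := by
    rw [hF]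
    simp [mollify]
  have hFh : F h = ∫ x, u (x + h) * φ x := by
    rw [hF, mollify, ← integral_add_right_eq_self (fun x => u x * φ (0 - (h - x))) h]
    simp
  have heq : ∫ x, (u (x + h) - u x) * φ x = F h - F 0 := by
    rw [hF0, hFh, ← integral_sub (integrable_mul_of_memLp_two (memLp_translate hu.memLp h) hφ.memLp)
      (integrable_mul_of_memLp_two hu.memLp hφ.memLp)]
    simp only [sub_mul]
  rw [heq, ← Real.norm_eq_abs]
  refine hmv.trans (le_of_eq ?_)
  rw [sub_zero]
  ring

/-! ### The nonlocal form -/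

/-- The Lévy weight `min(1, |h|)² / |h|^{N + 2s}`. -/
def levyWeight (N : ℕ) (s : ℝ) (h : E N) : ℝ :=
  (min 1 ‖h‖) ^ 2 / ‖h‖ ^ ((N : ℝ) + 2 * s)

theorem levyWeight_nonneg (s : ℝ) (h : E N) : 0 ≤ levyWeight N s h := by
  unfold levyWeight
  positivity

theorem integrable_levyWeight [NeZero N] {s : ℝ} (hs0 : 0 < s) (hs1 : s < 1) :
    Integrable (levyWeight N s) volume := by
  have hN : 1 ≤ N := NeZero.one_le
  refine (integrable_fun_norm_addHaar volume
    (f := fun r : ℝ => (min 1 r) ^ 2 / r ^ ((N : ℝ) + 2 * s))).2 ?_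
  rw [finrank_euclideanSpace_fin, ← Ioc_union_Ioi_eq_Ioi zero_le_one]
  have hpow : ∀ y : ℝ, 0 < y → y ^ (N - 1) = y ^ ((N : ℝ) - 1) := by
    intro y _
    rw [← Real.rpow_natCast, Nat.cast_sub hN, Nat.cast_one]
  refine IntegrableOn.union ?_ ?_
  · have h1 : IntegrableOn (fun y : ℝ => y ^ (1 - 2 * s)) (Ioc 0 1) :=
      (intervalIntegrable_iff_integrableOn_Ioc_of_le zero_le_one).1
        (intervalIntegral.intervalIntegrable_rpow' (by linarith))
    refine h1.congr_fun (fun y hy => ?_) measurableSet_Ioc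
    simp only [smul_eq_mul, min_eq_right hy.2]
    rw [hpow y hy.1, ← Real.rpow_natCast y 2, ← Real.rpow_sub hy.1, ← Real.rpow_add hy.1]
    congr 1
    push_cast
    ring
  · have h1 : IntegrableOn (fun y : ℝ => y ^ (-1 - 2 * s)) (Ioi 1) :=
      integrableOn_Ioi_rpow_of_lt (by linarith) one_pos
    refine h1.congr_fun (fun y hy => ?_) measurableSet_Ioi
    have hy0 : 0 < y := one_pos.trans hy
    simp only [smul_eq_mul, min_eq_left (le_of_lt (mem_Ioi.1 hy))]
    rw [hpow y hy0, one_pow, one_div, ← Real.rpow_neg hy0.le, ← Real.rpow_add hy0]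
    congr 1
    ring

/-- The `L²` pairing of the increments `u(· + h) - u` and `φ(· + h) - φ`. -/
def shiftForm (u φ : E N → ℝ) (h : E N) : ℝ :=
  ∫ x, (u (x + h) - u x) * (φ (x + h) - φ x)

/-- The bilinear form of the fractional Laplacian, with the integration over the increment
`h = y - x` performed last. -/
def nonlocalForm (s : ℝ) (u φ : E N → ℝ) : ℝ :=
  ∫ h, shiftForm u φ h / ‖h‖ ^ ((N : ℝ) + 2 * s)

theorem memLp_shift {u : E N → ℝ} (hu : MemLp u 2 volume) (h : E N) :
    MemLp (fun x => u (x + h) - u x) 2 volume :=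
  (memLp_translate hu h).sub hu

theorem l2_shift_le {u : E N → ℝ} {g : Fin N → E N → ℝ} (hu : HasWeakGrad u g) (h : E N) :
    l2 (fun x => u (x + h) - u x) ≤ 2 * min 1 ‖h‖ * gradNorm u g := by
  have h0 := gradNorm_nonneg u g
  rcases le_total 1 ‖h‖ with hh | hh
  · rw [min_eq_left hh]
    have := l2_sub_le (memLp_translate hu.memLp h) hu.memLp
    rw [l2_translate hu.memLp] at this
    linarith [l2_le_gradNorm u g]
  · rw [min_eq_right hh]
    refine (l2_translate_sub_le hu h).trans ?_
    have h1 : ∑ i, l2 (g i) ≤ gradNorm u g := le_add_of_nonneg_left (l2_nonneg u)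
    nlinarith [norm_nonneg h, mul_le_mul_of_nonneg_left h1 (norm_nonneg h),
      mul_nonneg (norm_nonneg h) h0]

theorem integral_abs_shift_mul_le {u φ : E N → ℝ} {g g' : Fin N → E N → ℝ}
    (hu : HasWeakGrad u g) (hφ : HasWeakGrad φ g') (h : E N) :
    ∫ x, |(u (x + h) - u x) * (φ (x + h) - φ x)| ≤
      4 * gradNorm u g * gradNorm φ g' * (min 1 ‖h‖) ^ 2 := by
  refine (integral_abs_mul_le (memLp_shift hu.memLp h) (memLp_shift hφ.memLp h)).trans ?_
  refine (mul_le_mul (l2_shift_le hu h) (l2_shift_le hφ h) (l2_nonneg _) ?_).trans (le_of_eq ?_)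
  · have := gradNorm_nonneg u g
    positivity
  · ring

theorem measurable_norm_rpow (a : ℝ) : Measurable fun h : E N => ‖h‖ ^ a :=
  measurable_norm.pow_const a

theorem aestronglyMeasurable_shift {u : E N → ℝ} (hu : AEStronglyMeasurable u volume) :
    AEStronglyMeasurable (fun p : E N × E N => u (p.1 + p.2) - u p.1) (volume.prod volume) := by
  refine AEStronglyMeasurable.sub ?_ hu.comp_fst
  exact hu.comp_quasiMeasurePreserving (Measure.quasiMeasurePreserving_snd.comp
    (measurePreserving_prod_add volume volume).quasiMeasurePreserving)

theorem integrable_shift_mul_div [NeZero N] {s : ℝ} (hs0 : 0 < s) (hs1 : s < 1)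
    {u φ : E N → ℝ} {g g' : Fin N → E N → ℝ} (hu : HasWeakGrad u g) (hφ : HasWeakGrad φ g') :
    Integrable (fun p : E N × E N => (u (p.1 + p.2) - u p.1) * (φ (p.1 + p.2) - φ p.1) /
      ‖p.2‖ ^ ((N : ℝ) + 2 * s)) (volume.prod volume) := by
  have hm : AEStronglyMeasurable (fun p : E N × E N =>
      (u (p.1 + p.2) - u p.1) * (φ (p.1 + p.2) - φ p.1) / ‖p.2‖ ^ ((N : ℝ) + 2 * s))
      (volume.prod volume) := by
    simp only [div_eq_mul_inv]
    refine ((aestronglyMeasurable_shift hu.memLp.1).mul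
      (aestronglyMeasurable_shift hφ.memLp.1)).mul ?_
    exact ((measurable_norm_rpow _).comp measurable_snd).inv.aestronglyMeasurable
  refine (integrable_prod_iff' hm).2 ⟨Filter.Eventually.of_forall fun h => ?_, ?_⟩
  · exact (integrable_mul_of_memLp_two (memLp_shift hu.memLp h) (memLp_shift hφ.memLp h)).div_const
      (‖h‖ ^ ((N : ℝ) + 2 * s))
  · refine Integrable.mono' ((integrable_levyWeight (N := N) hs0 hs1).const_mul
      (4 * gradNorm u g * gradNorm φ g')) hm.norm.prod_swap.integral_prod_right' ?_
    refine Filter.Eventually.of_forall fun h => ?_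
    have hw : 0 ≤ ‖h‖ ^ ((N : ℝ) + 2 * s) := by positivity
    rw [Real.norm_of_nonneg (integral_nonneg fun x => norm_nonneg _), levyWeight,
      ← mul_div_assoc]
    simp only [Real.norm_eq_abs, abs_div, abs_of_nonneg hw, integral_div]
    exact div_le_div_of_nonneg_right (integral_abs_shift_mul_le hu hφ h) hw

theorem integrable_shiftForm_div [NeZero N] {s : ℝ} (hs0 : 0 < s) (hs1 : s < 1)
    {u φ : E N → ℝ} {g g' : Fin N → E N → ℝ} (hu : HasWeakGrad u g) (hφ : HasWeakGrad φ g') :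
    Integrable fun h : E N => shiftForm u φ h / ‖h‖ ^ ((N : ℝ) + 2 * s) := by
  have := (integrable_shift_mul_div hs0 hs1 hu hφ).integral_prod_right
  simpa only [shiftForm, integral_div] using this

/-- The double integral of the weak formulation is the nonlocal form. -/
theorem integral_prod_eq_nonlocalForm [NeZero N] {s : ℝ} (hs0 : 0 < s) (hs1 : s < 1)
    {u φ : E N → ℝ} {g g' : Fin N → E N → ℝ} (hu : HasWeakGrad u g) (hφ : HasWeakGrad φ g') :
    (∫ p : E N × E N, (u p.1 - u p.2) * (φ p.1 - φ p.2) / ‖p.1 - p.2‖ ^ ((N : ℝ) + 2 * s)) =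
      nonlocalForm s u φ := by
  have hT : MeasurePreserving (fun p : E N × E N => (p.1, p.1 + p.2))
      (volume.prod volume) (volume.prod volume) := measurePreserving_prod_add volume volume
  have hemb : MeasurableEmbedding (fun p : E N × E N => (p.1, p.1 + p.2)) :=
    (MeasurableEquiv.shearAddRight (E N)).measurableEmbedding
  rw [Measure.volume_eq_prod, ← hT.integral_comp hemb]
  have hcongr : ∀ p : E N × E N, (u p.1 - u (p.1 + p.2)) * (φ p.1 - φ (p.1 + p.2)) /
      ‖p.1 - (p.1 + p.2)‖ ^ ((N : ℝ) + 2 * s) =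
      (u (p.1 + p.2) - u p.1) * (φ (p.1 + p.2) - φ p.1) / ‖p.2‖ ^ ((N : ℝ) + 2 * s) := by
    intro p
    rw [sub_add_cancel_left, norm_neg]
    ring
  simp only [hcongr]
  rw [integral_prod_symm _ (integrable_shift_mul_div hs0 hs1 hu hφ)]
  simp only [integral_div, nonlocalForm, shiftForm]

theorem nonlocalForm_self_nonneg (s : ℝ) (u : E N → ℝ) : 0 ≤ nonlocalForm s u u :=
  integral_nonneg fun h =>
    div_nonneg (integral_nonneg fun x => mul_self_nonneg _) (by positivity)

/-- Integration by parts in the nonlocal form. -/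
theorem nonlocalForm_classicalPartial {φ ψ : E N → ℝ} (hφ : IsTestFunction univ φ)
    (hψ : IsTestFunction univ ψ) (s : ℝ) (i : Fin N) :
    nonlocalForm s φ (classicalPartial i ψ) = -nonlocalForm s (classicalPartial i φ) ψ := by
  have key : ∀ {χ : E N → ℝ}, IsTestFunction univ χ → ∀ h x : E N,
      classicalPartial i χ (x + h) - classicalPartial i χ x =
        classicalPartial i (fun y => χ (y + h) - χ y) x := by
    intro χ hχ h x
    rw [classicalPartial_sub (hχ.translate h).differentiable hχ.differentiable,
      classicalPartial_translate]
  unfold nonlocalForm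
  rw [← integral_neg]
  refine integral_congr_ae (Filter.Eventually.of_forall fun h => ?_)
  simp only [shiftForm, key hφ, key hψ]
  rw [integral_mul_classicalPartial ((hφ.translate h).sub hφ) ((hψ.translate h).sub hψ), neg_div]

/-- Mollification can be moved from one argument of the nonlocal form to the other. -/
theorem nonlocalForm_mollify {ρ u φ : E N → ℝ} (hρ : IsMollifier ρ) (hu : Integrable u volume)
    (hφ : IsTestFunction univ φ) (s : ℝ) :
    nonlocalForm s (mollify ρ u) φ = nonlocalForm s u (mollify ρ φ) := by
  have key : ∀ {w : E N → ℝ}, Integrable w volume → ∀ h x : E N,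
      mollify ρ w (x + h) - mollify ρ w x = mollify ρ (fun y => w (y + h) - w y) x := by
    intro w hw h x
    have hex : ∀ {v : E N → ℝ}, Integrable v volume → Integrable fun t => v t * ρ (x - t) :=
      fun hv => hρ.test.2.1.convolutionExists_right (ContinuousLinearMap.mul ℝ ℝ)
        hv.locallyIntegrable hρ.test.continuous x
    rw [← mollify_translate]
    simp only [mollify, sub_mul]
    rw [integral_sub (hex (hw.comp_add_right h)) (hex hw)]
  unfold nonlocalForm
  refine integral_congr_ae (Filter.Eventually.of_forall fun h => ?_)
  simp only [shiftForm, key hu, key hφ.integrable]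
  have hu' : Integrable (fun x => u (x + h) - u x) volume := (hu.comp_add_right h).sub hu
  rw [integral_mollify_mul hρ.test hρ.even hu' ((hφ.translate h).sub hφ)]

/-- First and second increments of a test function. -/
theorem IsTestFunction.exists_increment_bound {η : E N → ℝ} (hη : IsTestFunction univ η) :
    ∃ C : ℝ, 0 ≤ C ∧ (∀ x h, |η x - η (x + h)| ≤ C * min 1 ‖h‖) ∧
      ∀ x h, |2 * η x - η (x + h) - η (x - h)| ≤ C * (min 1 ‖h‖) ^ 2 := by
  obtain ⟨C₀, hC₀, hb⟩ := hη.exists_bound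
  obtain ⟨C₁, hL₁⟩ := hη.1.lipschitzWith_of_hasCompactSupport hη.2.1 (by simp)
  have hd : ContDiff ℝ ∞ (fderiv ℝ η) := hη.1.fderiv_right (by simp)
  obtain ⟨C₂, hL₂⟩ := hd.lipschitzWith_of_hasCompactSupport (hη.2.1.fderiv (𝕜 := ℝ)) (by simp)
  have hC₁ : (0 : ℝ) ≤ C₁ := C₁.2
  have hC₂ : (0 : ℝ) ≤ C₂ := C₂.2
  have hsecond : ∀ x h, |2 * η x - η (x + h) - η (x - h)| ≤ C₂ * ‖h‖ ^ 2 := by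
    intro x h
    -- the mean value inequality for `y ↦ η (y + h) - η y` on the segment from `x - h` to `x`
    have hdiff : ∀ y, HasFDerivAt (fun y => η (y + h) - η y)
        (fderiv ℝ η (y + h) - fderiv ℝ η y) y := fun y =>
      ((hasFDerivAt_comp_add_right h).2 (hη.differentiable (y + h)).hasFDerivAt).sub
        (hη.differentiable y).hasFDerivAt
    have hmv := Convex.norm_image_sub_le_of_norm_hasFDerivWithin_le (𝕜 := ℝ) (s := univ)
      (C := C₂ * ‖h‖) (x := x - h) (y := x) (fun y _ => (hdiff y).hasFDerivWithinAt)
      (fun y _ => by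
        have := hL₂.dist_le_mul (y + h) y
        rwa [dist_eq_norm, dist_eq_norm, add_sub_cancel_left] at this)
      convex_univ (mem_univ _) (mem_univ _)
    rw [sub_sub_cancel, sub_add_cancel, Real.norm_eq_abs, abs_sub_comm] at hmv
    refine (le_of_eq ?_).trans (hmv.trans (le_of_eq (by ring)))
    congr 1
    ring
  refine ⟨4 * C₀ + C₁ + C₂, by positivity, fun x h => ?_, fun x h => ?_⟩
  · rcases le_total 1 ‖h‖ with hh | hh
    · rw [min_eq_left hh]
      have := abs_sub (η x) (η (x + h))
      linarith [hb x, hb (x + h)]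
    · rw [min_eq_right hh]
      have := hL₁.dist_le_mul x (x + h)
      rw [Real.dist_eq, dist_eq_norm, sub_add_cancel_left, norm_neg] at this
      nlinarith [norm_nonneg h]
  · rcases le_total 1 ‖h‖ with hh | hh
    · rw [min_eq_left hh]
      have h1 := abs_le.1 (hb x)
      have h2 := abs_le.1 (hb (x + h))
      have h3 := abs_le.1 (hb (x - h))
      exact abs_le.2 ⟨by linarith, by linarith⟩
    · rw [min_eq_right hh]
      have := hsecond x h
      nlinarith [sq_nonneg ‖h‖]

/-- The commutator of the pairing of increments with the multiplication by a test function is of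
second order in `h`: after symmetrization in `h`, either both `η` and `u` are differenced once, or
`η` is differenced twice, and `φ` is not differenced at all. -/
theorem abs_shiftForm_commutator_le {η u φ : E N → ℝ} {g : Fin N → E N → ℝ} {C : ℝ} (hC0 : 0 ≤ C)
    (hη : IsTestFunction univ η) (h1 : ∀ x h, |η x - η (x + h)| ≤ C * min 1 ‖h‖)
    (h2 : ∀ x h, |2 * η x - η (x + h) - η (x - h)| ≤ C * (min 1 ‖h‖) ^ 2)
    (hu : HasWeakGrad u g) (hφ : IsTestFunction univ φ) (h : E N) :
    |shiftForm (fun x => η x * u x) φ h - shiftForm u (fun x => η x * φ x) h| ≤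
      5 * C * gradNorm u g * l2 φ * (min 1 ‖h‖) ^ 2 := by
  obtain ⟨C₀, -, hb⟩ := hη.exists_bound
  have hηu : MemLp (fun x => η x * u x) 2 volume := memLp_bdd_mul hη.continuous hb hu.memLp
  have hηφ : MemLp (fun x => η x * φ x) 2 volume := memLp_bdd_mul hη.continuous hb hφ.memLp
  have hcont : ∀ k : E N, Continuous fun x => η x - η (x + k) := fun k =>
    hη.continuous.sub (hη.continuous.comp (continuous_add_const k))
  have hm0 : (0 : ℝ) ≤ min 1 ‖h‖ := by positivity
  -- the increment of `u` multiplied by the increment of `η`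
  have hA : ∀ k : E N, ‖k‖ = ‖h‖ →
      MemLp (fun x => (η x - η (x + k)) * (u (x + k) - u x)) 2 volume ∧
      l2 (fun x => (η x - η (x + k)) * (u (x + k) - u x)) ≤
        2 * C * gradNorm u g * (min 1 ‖h‖) ^ 2 := by
    intro k hk
    have hbk : ∀ x, |η x - η (x + k)| ≤ C * min 1 ‖h‖ := fun x => hk ▸ h1 x k
    refine ⟨memLp_bdd_mul (hcont k) hbk (memLp_shift hu.memLp k), ?_⟩
    refine (l2_bdd_mul_le hbk (memLp_shift hu.memLp k)).trans ?_
    refine (mul_le_mul_of_nonneg_left (l2_shift_le hu k) (by positivity)).trans (le_of_eq ?_)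
    rw [hk]
    ring
  have hcont2 : Continuous fun x => 2 * η x - η (x + h) - η (x - h) :=
    ((continuous_const.mul hη.continuous).sub
      (hη.continuous.comp (continuous_add_const h))).sub
      (hη.continuous.comp (continuous_sub_right h))
  have hB := memLp_bdd_mul hcont2 (fun x => h2 x h) hu.memLp
  have hBn : l2 (fun x => (2 * η x - η (x + h) - η (x - h)) * u x) ≤
      C * gradNorm u g * (min 1 ‖h‖) ^ 2 := by
    refine (l2_bdd_mul_le (fun x => h2 x h) hu.memLp).trans ?_
    refine (mul_le_mul_of_nonneg_left (l2_le_gradNorm u g) (by positivity)).trans (le_of_eq ?_)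
    ring
  obtain ⟨hA1, hA1n⟩ := hA h rfl
  obtain ⟨hA2, hA2n⟩ := hA (-h) (norm_neg h)
  -- the functions paired with `φ`
  have hP : MemLp (fun x => (η x - η (x + h)) * u (x + h)) 2 volume :=
    memLp_bdd_mul (hcont h) (fun x => h1 x h) (memLp_translate hu.memLp h)
  have hQ : MemLp (fun x => (η x - η (x + h)) * u x) 2 volume :=
    memLp_bdd_mul (hcont h) (fun x => h1 x h) hu.memLp
  have hR : MemLp (fun x => (η (x - h) - η x) * u (x - h)) 2 volume := by
    have := memLp_translate hQ (-h)
    simpa only [← sub_eq_add_neg, sub_add_cancel] using this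
  have e1 : shiftForm (fun x => η x * u x) φ h - shiftForm u (fun x => η x * φ x) h =
      (∫ x, (η x - η (x + h)) * u (x + h) * φ x) - ∫ x, (η x - η (x + h)) * u x * φ (x + h) := by
    unfold shiftForm
    rw [← integral_sub, ← integral_sub]
    · refine integral_congr_ae (Filter.Eventually.of_forall fun x => ?_)
      simp only
      ring
    · exact integrable_mul_of_memLp_two hP hφ.memLp
    · exact integrable_mul_of_memLp_two hQ (memLp_translate hφ.memLp h)
    · exact integrable_mul_of_memLp_two (memLp_shift hηu h) (memLp_shift hφ.memLp h)
    · exact integrable_mul_of_memLp_two (memLp_shift hu.memLp h) (memLp_shift hηφ h)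
  have e2 : ∫ x, (η x - η (x + h)) * u x * φ (x + h) =
      ∫ x, (η (x - h) - η x) * u (x - h) * φ x := by
    rw [← integral_sub_right_eq_self (fun x => (η x - η (x + h)) * u x * φ (x + h)) h]
    simp only [sub_add_cancel]
  have e3 : (∫ x, (η x - η (x + h)) * u (x + h) * φ x) -
      ∫ x, (η (x - h) - η x) * u (x - h) * φ x =
      (∫ x, (η x - η (x + h)) * (u (x + h) - u x) * φ x) +
      (∫ x, (η x - η (x + -h)) * (u (x + -h) - u x) * φ x) +
      ∫ x, (2 * η x - η (x + h) - η (x - h)) * u x * φ x := by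
    have i1 := integrable_mul_of_memLp_two hA1 hφ.memLp
    have i2 := integrable_mul_of_memLp_two hA2 hφ.memLp
    have i12 : Integrable (fun x => (η x - η (x + h)) * (u (x + h) - u x) * φ x +
      (η x - η (x + -h)) * (u (x + -h) - u x) * φ x) volume := i1.add i2
    rw [← integral_sub (integrable_mul_of_memLp_two hP hφ.memLp)
      (integrable_mul_of_memLp_two hR hφ.memLp), ← integral_add i1 i2,
      ← integral_add i12 (integrable_mul_of_memLp_two hB hφ.memLp)]
    refine integral_congr_ae (Filter.Eventually.of_forall fun x => ?_)
    simp only [← sub_eq_add_neg]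
    ring
  rw [e1, e2, e3]
  have b1 := (abs_integral_mul_le hA1 hφ.memLp).trans
    (mul_le_mul_of_nonneg_right hA1n (l2_nonneg φ))
  have b2 := (abs_integral_mul_le hA2 hφ.memLp).trans
    (mul_le_mul_of_nonneg_right hA2n (l2_nonneg φ))
  have b3 := (abs_integral_mul_le hB hφ.memLp).trans
    (mul_le_mul_of_nonneg_right hBn (l2_nonneg φ))
  refine (abs_add_three _ _ _).trans ((add_le_add (add_le_add b1 b2) b3).trans (le_of_eq ?_))
  unfold l2
  ring

/-! ### Regularity on the whole space -/

/-- If the distributional derivative `∂_i w` of `w ∈ L²(ℝ^N)` is bounded by `M` in the `L²`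
duality, then it is a function of `L²` norm at most `M`. -/
theorem exists_isWeakPartial_of_bound {w : E N → ℝ} {M : ℝ} {i : Fin N} (hw : MemLp w 2 volume)
    (hM0 : 0 ≤ M)
    (hM : ∀ φ, IsTestFunction univ φ → |∫ x, w x * classicalPartial i φ x| ≤ M * l2 φ) :
    ∃ G, IsWeakPartial univ i w G ∧ MemLp G 2 volume ∧ l2 G ≤ M := by
  obtain ⟨G, hG, hle, heq⟩ := exists_memLp_of_bound
    (L := fun φ => -∫ x, w x * classicalPartial i φ x) hM0
    (fun φ ψ hφ hψ => by
      simp only [classicalPartial_add hφ.differentiable hψ.differentiable, mul_add]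
      rw [integral_add (integrable_mul_of_memLp_two hw (hφ.partial_deriv i).memLp)
        (integrable_mul_of_memLp_two hw (hψ.partial_deriv i).memLp), neg_add])
    (fun c φ hφ => by
      simp only [classicalPartial_const_mul hφ.differentiable, mul_left_comm _ c]
      rw [integral_const_mul, mul_neg])
    (fun φ hφ => by
      rw [abs_neg]
      exact hM φ hφ)
  refine ⟨G, ⟨(hw.locallyIntegrable (by norm_num)).locallyIntegrableOn _,
    (hG.locallyIntegrable (by norm_num)).locallyIntegrableOn _, fun φ hφ => ?_⟩, hG, hle⟩
  rw [Measure.restrict_univ, ← heq φ hφ, neg_neg]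

/-- The energy estimate for smooth functions: testing the equation of `v` with `∂_i ∂_i v` controls
all the second derivatives `∂_i ∂_j v`, because the nonlocal form contributes with a sign. -/
theorem l2_second_partial_le {v : E N → ℝ} (hv : IsTestFunction univ v) {s c M : ℝ} (hc : 0 ≤ c)
    (hM0 : 0 ≤ M)
    (hM : ∀ φ, IsTestFunction univ φ →
      |(∑ j, ∫ x, classicalPartial j v x * classicalPartial j φ x) + c * nonlocalForm s v φ| ≤
        M * l2 φ) (i j : Fin N) :
    l2 (classicalPartial i (classicalPartial j v)) ≤ M := by
  have hψ : ∀ k, IsTestFunction univ (classicalPartial k v) := fun k => hv.partial_deriv k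
  have hloc : ∀ k, ∫ x, classicalPartial k v x *
      classicalPartial k (classicalPartial i (classicalPartial i v)) x =
      -l2 (classicalPartial i (classicalPartial k v)) ^ 2 := by
    intro k
    have e1 : classicalPartial k (classicalPartial i (classicalPartial i v)) =
        classicalPartial i (classicalPartial k (classicalPartial i v)) :=
      funext fun x => classicalPartial_comm (hψ i) k i x
    have e2 : classicalPartial k (classicalPartial i v) =
        classicalPartial i (classicalPartial k v) :=
      funext fun x => classicalPartial_comm hv k i x
    rw [e1, e2, integral_mul_classicalPartial (hψ k) ((hψ k).partial_deriv i),
      integral_mul_self_eq ((hψ k).partial_deriv i).memLp]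
    rfl
  have hsum : ∑ k, l2 (classicalPartial i (classicalPartial k v)) ^ 2 ≤
      M * l2 (classicalPartial i (classicalPartial i v)) := by
    have h := hM _ ((hψ i).partial_deriv i)
    simp only [hloc] at h
    rw [nonlocalForm_classicalPartial hv (hψ i), Finset.sum_neg_distrib] at h
    have h1 := (abs_le.1 h).1
    have h2 := mul_nonneg hc (nonlocalForm_self_nonneg s (classicalPartial i v))
    linarith
  have hle : ∀ k, l2 (classicalPartial i (classicalPartial k v)) ^ 2 ≤
      M * l2 (classicalPartial i (classicalPartial i v)) := fun k =>
    (Finset.single_le_sum (f := fun k => l2 (classicalPartial i (classicalPartial k v)) ^ 2)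
      (fun k _ => sq_nonneg _) (Finset.mem_univ k)).trans hsum
  have hii : l2 (classicalPartial i (classicalPartial i v)) ≤ M := by
    have := hle i
    by_contra! hlt
    nlinarith
  refine le_of_sq_le_sq ?_ hM0
  refine (hle j).trans ?_
  rw [sq]
  exact mul_le_mul_of_nonneg_left hii hM0

/-- A compactly supported function of `H¹(ℝ^N)` whose image under `-Δ + 2c (-Δ)^s / c_{N,s}` is
bounded by `M` in the `L²` duality has second derivatives of `L²` norm at most `M`. -/
theorem exists_second_weakPartial {v : E N → ℝ} {g : Fin N → E N → ℝ} (hv : HasWeakGrad v g)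
    (hvc : HasCompactSupport v) (hgc : ∀ j, HasCompactSupport (g j)) {s c M : ℝ} (hc : 0 ≤ c)
    (hM0 : 0 ≤ M)
    (hM : ∀ φ, IsTestFunction univ φ →
      |(∑ j, ∫ x, g j x * classicalPartial j φ x) + c * nonlocalForm s v φ| ≤ M * l2 φ)
    (i j : Fin N) :
    ∃ G, IsWeakPartial univ i (g j) G ∧ MemLp G 2 volume ∧ l2 G ≤ M := by
  have hint : ∀ {w : E N → ℝ}, MemLp w 2 volume → HasCompactSupport w → Integrable w volume := by
    intro w hw hwc
    refine (integrableOn_iff_integrable_of_support_subset (subset_tsupport w)).1 ?_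
    exact (hw.locallyIntegrable (by norm_num)).integrableOn_isCompact hwc
  have hvi := hint hv.memLp hvc
  have hgi := fun k => hint (hv.grad_memLp k) (hgc k)
  -- the mollified equation
  have hmol : ∀ ρ, IsMollifier ρ → ∀ φ, IsTestFunction univ φ →
      |∫ x, mollify ρ (g j) x * classicalPartial i φ x| ≤ M * l2 φ := by
    intro ρ hρ φ hφ
    have hvρ : IsTestFunction univ (mollify ρ v) :=
      isTestFunction_mollify hρ.test hvi.locallyIntegrable hvc
    have hpart : ∀ k, classicalPartial k (mollify ρ v) = mollify ρ (g k) := fun k =>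
      funext fun x => classicalPartial_mollify hρ.test (hv.weak k) x
    have hMρ : ∀ ψ, IsTestFunction univ ψ →
        |(∑ k, ∫ x, classicalPartial k (mollify ρ v) x * classicalPartial k ψ x) +
          c * nonlocalForm s (mollify ρ v) ψ| ≤ M * l2 ψ := by
      intro ψ hψ
      have h := hM _ (isTestFunction_mollify hρ.test hψ.continuous.locallyIntegrable hψ.2.1)
      have e : ∀ k, ∫ x, classicalPartial k (mollify ρ v) x * classicalPartial k ψ x =
          ∫ x, g k x * classicalPartial k (mollify ρ ψ) x := by
        intro k
        rw [hpart k, integral_mollify_mul hρ.test hρ.even (hgi k) (hψ.partial_deriv k)]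
        simp only [classicalPartial_mollify hρ.test ((HasWeakGrad.of_test hψ).weak k)]
      simp only [e]
      rw [nonlocalForm_mollify hρ hvi hψ]
      exact h.trans (mul_le_mul_of_nonneg_left (l2_mollify_le hρ hψ) hM0)
    rw [← hpart j, integral_mul_classicalPartial (hvρ.partial_deriv j) hφ, abs_neg]
    exact (abs_integral_mul_le ((hvρ.partial_deriv j).partial_deriv i).memLp hφ.memLp).trans
      (mul_le_mul_of_nonneg_right (l2_second_partial_le hvρ hc hM0 hMρ i j) (l2_nonneg φ))
  refine exists_isWeakPartial_of_bound (hv.grad_memLp j) hM0 fun φ hφ => ?_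
  have hφi := hφ.partial_deriv i
  refine le_of_forall_pos_le_add fun ε hε => ?_
  have hI : 0 ≤ ∫ x, |g j x| := integral_nonneg fun x => abs_nonneg _
  obtain ⟨ρ, hρ, hclose⟩ := exists_isMollifier_dist_le hφi
    (div_pos hε (by linarith : 0 < (∫ x, |g j x|) + 1))
  have h1 := hmol ρ hρ φ hφ
  rw [integral_mollify_mul hρ.test hρ.even (hgi j) hφi] at h1
  have hmt : IsTestFunction univ (mollify ρ (classicalPartial i φ)) :=
    isTestFunction_mollify hρ.test hφi.continuous.locallyIntegrable hφi.2.1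
  have h2 : |(∫ x, g j x * mollify ρ (classicalPartial i φ) x) -
      ∫ x, g j x * classicalPartial i φ x| ≤ ε := by
    rw [← integral_sub (integrable_mul_of_memLp_two (hv.grad_memLp j) hmt.memLp)
      (integrable_mul_of_memLp_two (hv.grad_memLp j) hφi.memLp), ← Real.norm_eq_abs]
    have h3 : ∫ x, |g j x| * (ε / ((∫ x, |g j x|) + 1)) ≤ ε := by
      rw [integral_mul_const, ← mul_div_assoc, div_le_iff₀ (by linarith)]
      nlinarith
    refine (norm_integral_le_of_norm_le ((hgi j).abs.mul_const _) ?_).trans h3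
    refine Filter.Eventually.of_forall fun x => ?_
    rw [← mul_sub, norm_mul]
    exact mul_le_mul_of_nonneg_left (hclose x) (norm_nonneg _)
  have h4 := abs_sub_abs_le_abs_sub (∫ x, g j x * classicalPartial i φ x)
    (∫ x, g j x * mollify ρ (classicalPartial i φ) x)
  rw [abs_sub_comm] at h2
  linarith

/-! ### Localization -/

theorem IsTestFunction.exists_uniform_bound {U : Set (E N)} {η : E N → ℝ}
    (hη : IsTestFunction U η) :
    ∃ C : ℝ, 0 ≤ C ∧ (∀ x, |η x| ≤ C) ∧ (∀ i x, |classicalPartial i η x| ≤ C) ∧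
      ∀ i x, |classicalPartial i (classicalPartial i η) x| ≤ C := by
  obtain ⟨C, hC0, hC⟩ := hη.exists_bound
  choose A hA0 hA using fun i => (hη.partial_deriv i).exists_bound
  choose B hB0 hB using fun i => ((hη.partial_deriv i).partial_deriv i).exists_bound
  have hsA : 0 ≤ ∑ i, A i := Finset.sum_nonneg fun i _ => hA0 i
  have hsB : 0 ≤ ∑ i, B i := Finset.sum_nonneg fun i _ => hB0 i
  refine ⟨C + ∑ i, A i + ∑ i, B i, by linarith, fun x => by linarith [hC x], fun i x => ?_,
    fun i x => ?_⟩
  · linarith [hA i x, Finset.single_le_sum (fun k _ => hA0 k) (Finset.mem_univ i)]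
  · linarith [hB i x, Finset.single_le_sum (fun k _ => hB0 k) (Finset.mem_univ i)]

/-- The product rule for the weak gradient of `η u`. -/
theorem HasWeakGrad.test_mul {η u : E N → ℝ} {g : Fin N → E N → ℝ} (hη : IsTestFunction univ η)
    (hu : HasWeakGrad u g) :
    HasWeakGrad (fun x => η x * u x) fun i x => η x * g i x + classicalPartial i η x * u x := by
  obtain ⟨C, -, hC, hC1, -⟩ := hη.exists_uniform_bound
  have h1 := memLp_bdd_mul hη.continuous hC hu.memLp
  have h2 : ∀ i, MemLp (fun x => η x * g i x + classicalPartial i η x * u x) 2 volume := fun i =>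
    (memLp_bdd_mul hη.continuous hC (hu.grad_memLp i)).add
      (memLp_bdd_mul (hη.partial_deriv i).continuous (hC1 i) hu.memLp)
  refine ⟨h1, h2, fun i => ⟨(h1.locallyIntegrable (by norm_num)).locallyIntegrableOn _,
    ((h2 i).locallyIntegrable (by norm_num)).locallyIntegrableOn _, fun φ hφ => ?_⟩⟩
  have hηφ := hη.mul_smooth hφ.1
  have hw := (hu.weak i).2.2 _ hηφ
  have hdφ := (hη.partial_deriv i).mul_smooth hφ.1
  simp only [Measure.restrict_univ] at hw ⊢
  have e1 : ∫ x, η x * u x * classicalPartial i φ x =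
      (∫ x, u x * classicalPartial i (fun x => η x * φ x) x) -
        ∫ x, u x * (classicalPartial i η x * φ x) := by
    rw [← integral_sub (integrable_mul_of_memLp_two hu.memLp (hηφ.partial_deriv i).memLp)
      (integrable_mul_of_memLp_two hu.memLp hdφ.memLp)]
    refine integral_congr_ae (Filter.Eventually.of_forall fun x => ?_)
    simp only [classicalPartial_mul hη.differentiable hφ.differentiable]
    ring
  have e2 : ∫ x, (η x * g i x + classicalPartial i η x * u x) * φ x =
      (∫ x, g i x * (η x * φ x)) + ∫ x, u x * (classicalPartial i η x * φ x) := by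
    rw [← integral_add (integrable_mul_of_memLp_two (hu.grad_memLp i) hηφ.memLp)
      (integrable_mul_of_memLp_two hu.memLp hdφ.memLp)]
    refine integral_congr_ae (Filter.Eventually.of_forall fun x => ?_)
    simp only
    ring
  rw [e1, e2, hw]
  ring

/-- The commutator of the Laplacian with the multiplication by `η`. -/
theorem integral_grad_commutator {η u φ : E N → ℝ} {g : Fin N → E N → ℝ}
    (hη : IsTestFunction univ η) (hu : HasWeakGrad u g) (hφ : IsTestFunction univ φ) (i : Fin N) :
    ∫ x, (η x * g i x + classicalPartial i η x * u x) * classicalPartial i φ x =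
      (∫ x, g i x * classicalPartial i (fun x => η x * φ x) x) -
        ((∫ x, 2 * (g i x * (classicalPartial i η x * φ x))) +
          ∫ x, u x * (classicalPartial i (classicalPartial i η) x * φ x)) := by
  have hηφ := hη.mul_smooth hφ.1
  have hη1 := hη.partial_deriv i
  have hη1φ := hη1.mul_smooth hφ.1
  have hη2φ := (hη1.partial_deriv i).mul_smooth hφ.1
  have hw := (hu.weak i).2.2 _ hη1φ
  simp only [Measure.restrict_univ] at hw
  have i1 := integrable_mul_of_memLp_two (hu.grad_memLp i) (hηφ.partial_deriv i).memLp
  have i2 := integrable_mul_of_memLp_two (hu.grad_memLp i) hη1φ.memLp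
  have i3 := integrable_mul_of_memLp_two hu.memLp (hη1φ.partial_deriv i).memLp
  have i4 := integrable_mul_of_memLp_two hu.memLp hη2φ.memLp
  have e : ∫ x, (η x * g i x + classicalPartial i η x * u x) * classicalPartial i φ x =
      ((∫ x, g i x * classicalPartial i (fun x => η x * φ x) x) -
        ∫ x, g i x * (classicalPartial i η x * φ x)) +
      ((∫ x, u x * classicalPartial i (fun x => classicalPartial i η x * φ x) x) -
        ∫ x, u x * (classicalPartial i (classicalPartial i η) x * φ x)) := by
    rw [← integral_sub i1 i2, ← integral_sub i3 i4, ← integral_add (i1.sub' i2) (i3.sub' i4)]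
    refine integral_congr_ae (Filter.Eventually.of_forall fun x => ?_)
    simp only [classicalPartial_mul hη.differentiable hφ.differentiable,
      classicalPartial_mul hη1.differentiable hφ.differentiable]
    ring
  rw [e, hw, integral_const_mul]
  ring

/-- The commutator of the nonlocal form with the multiplication by `η` is bounded in `L²` by the
`H¹` norm of `u`. -/
theorem exists_nonlocalForm_commutator_bound [NeZero N] {s : ℝ} (hs0 : 0 < s) (hs1 : s < 1)
    {η : E N → ℝ} (hη : IsTestFunction univ η) :
    ∃ K : ℝ, 0 ≤ K ∧ ∀ (u φ : E N → ℝ) (g : Fin N → E N → ℝ), HasWeakGrad u g →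
      IsTestFunction univ φ →
      |nonlocalForm s (fun x => η x * u x) φ - nonlocalForm s u (fun x => η x * φ x)| ≤
        K * gradNorm u g * l2 φ := by
  obtain ⟨C, hC0, h1, h2⟩ := hη.exists_increment_bound
  have hJ : 0 ≤ ∫ h, levyWeight N s h := integral_nonneg fun h => levyWeight_nonneg s h
  refine ⟨5 * C * ∫ h, levyWeight N s h, by positivity, fun u φ g hu hφ => ?_⟩
  have hηφ := HasWeakGrad.of_test (hη.mul_smooth hφ.1)
  unfold nonlocalForm
  rw [← integral_sub
    (integrable_shiftForm_div hs0 hs1 (hu.test_mul hη) (HasWeakGrad.of_test hφ))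
    (integrable_shiftForm_div hs0 hs1 hu hηφ), ← Real.norm_eq_abs]
  have hrw : 5 * C * (∫ h, levyWeight N s h) * gradNorm u g * l2 φ =
      ∫ h, 5 * C * gradNorm u g * l2 φ * levyWeight N s h := by
    rw [integral_const_mul]
    ring
  rw [hrw]
  refine norm_integral_le_of_norm_le ((integrable_levyWeight hs0 hs1).const_mul _)
    (Filter.Eventually.of_forall fun h => ?_)
  have hw : 0 ≤ ‖h‖ ^ ((N : ℝ) + 2 * s) := by positivity
  rw [← sub_div, norm_div, Real.norm_eq_abs, Real.norm_of_nonneg hw, levyWeight, ← mul_div_assoc]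
  exact div_le_div_of_nonneg_right (abs_shiftForm_commutator_le hC0 hη h1 h2 hu hφ h) hw

/-- If `u` solves the equation weakly in `Ω`, then `η u` solves on the whole space an equation with
right-hand side in `L²`, bounded by the `L²` norm of `f` and the `H¹` norm of `u`. -/
theorem exists_localized_bound [NeZero N] {s c : ℝ} (hs0 : 0 < s) (hs1 : s < 1) (hc : 0 ≤ c)
    {Ω : Set (E N)} {η : E N → ℝ} (hη : IsTestFunction Ω η) :
    ∃ C : ℝ, 0 ≤ C ∧ ∀ (f u : E N → ℝ) (g : Fin N → E N → ℝ),
      MemLp f 2 (volume.restrict Ω) → HasWeakGrad u g →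
      (∀ φ, IsTestFunction Ω φ →
        (∑ i, ∫ x, g i x * classicalPartial i φ x) + c * nonlocalForm s u φ =
          ∫ x in Ω, f x * φ x) →
      ∀ φ, IsTestFunction univ φ →
        |(∑ i, ∫ x, (η x * g i x + classicalPartial i η x * u x) * classicalPartial i φ x) +
          c * nonlocalForm s (fun x => η x * u x) φ| ≤
          C * (normL2 Ω f + gradNorm u g) * l2 φ := by
  obtain ⟨A, hA0, hA, hA1, hA2⟩ := hη.exists_uniform_bound
  obtain ⟨K, hK0, hK⟩ := exists_nonlocalForm_commutator_bound hs0 hs1 hη.toUniv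
  refine ⟨A + N * (3 * A) + c * K, by positivity, fun f u g hf hu heq φ hφ => ?_⟩
  have hD0 := gradNorm_nonneg u g
  have hφ0 := l2_nonneg φ
  have hηφ := hη.mul_smooth hφ.1
  have hbd : ∀ {χ w : E N → ℝ}, (∀ x, |χ x| ≤ A) → Continuous χ → MemLp w 2 volume →
      l2 w ≤ gradNorm u g → |∫ x, w x * (χ x * φ x)| ≤ A * gradNorm u g * l2 φ := by
    intro χ w hχ hχc hw hwD
    refine (abs_integral_mul_le hw (memLp_bdd_mul hχc hχ hφ.memLp)).trans ?_
    refine (mul_le_mul hwD (l2_bdd_mul_le hχ hφ.memLp) (l2_nonneg _) hD0).trans (le_of_eq ?_)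
    ring
  have hcomm : |∑ i, ((∫ x, 2 * (g i x * (classicalPartial i η x * φ x))) +
      ∫ x, u x * (classicalPartial i (classicalPartial i η) x * φ x))| ≤
      N * (3 * A) * gradNorm u g * l2 φ := by
    refine (Finset.abs_sum_le_sum_abs _ _).trans ?_
    refine (Finset.sum_le_sum (g := fun _ => 3 * A * gradNorm u g * l2 φ) fun i _ => ?_).trans ?_
    · refine (abs_add_le _ _).trans ?_
      rw [integral_const_mul, abs_mul, abs_two]
      have b1 := hbd (hA1 i) (hη.partial_deriv i).continuous (hu.grad_memLp i)
        (l2_grad_le_gradNorm u g i)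
      have b2 := hbd (hA2 i) ((hη.partial_deriv i).partial_deriv i).continuous hu.memLp
        (l2_le_gradNorm u g)
      linarith
    · rw [Finset.sum_const, Finset.card_univ, Fintype.card_fin, nsmul_eq_mul]
      exact le_of_eq (by ring)
  have hrhs : |∫ x in Ω, f x * (η x * φ x)| ≤ A * normL2 Ω f * l2 φ := by
    have hm : MemLp (fun x => η x * φ x) 2 volume := hηφ.memLp
    refine (abs_integral_mul_le hf (hm.restrict Ω)).trans ?_
    refine (mul_le_mul_of_nonneg_left ((normL2_le_l2 hm Ω).trans
      (l2_bdd_mul_le hA hφ.memLp)) ENNReal.toReal_nonneg).trans (le_of_eq ?_)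
    unfold normL2
    ring
  have hnl := mul_le_mul_of_nonneg_left (hK u φ g hu hφ) hc
  rw [← abs_of_nonneg hc, ← abs_mul, abs_of_nonneg hc] at hnl
  have hsplit : (∑ i, ∫ x, (η x * g i x + classicalPartial i η x * u x) *
      classicalPartial i φ x) + c * nonlocalForm s (fun x => η x * u x) φ =
      (∫ x in Ω, f x * (η x * φ x)) -
        (∑ i, ((∫ x, 2 * (g i x * (classicalPartial i η x * φ x))) +
          ∫ x, u x * (classicalPartial i (classicalPartial i η) x * φ x))) +
        c * (nonlocalForm s (fun x => η x * u x) φ - nonlocalForm s u (fun x => η x * φ x)) := by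
    simp only [integral_grad_commutator hη.toUniv hu hφ]
    rw [← heq _ hηφ, Finset.sum_sub_distrib]
    ring
  rw [hsplit]
  refine (abs_add_le _ _).trans ((add_le_add_left (abs_sub _ _) _).trans ?_)
  have hF0 := normL2_nonneg Ω f
  have p1 : 0 ≤ A * gradNorm u g * l2 φ := by positivity
  have p2 : 0 ≤ N * (3 * A) * normL2 Ω f * l2 φ := by positivity
  have p3 : 0 ≤ c * K * normL2 Ω f * l2 φ := by positivity
  nlinarith

/-! ### Weak derivatives on subdomains -/

theorem IsWeakPartial.mono {U W : Set (E N)} {i : Fin N} {u g : E N → ℝ}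
    (h : IsWeakPartial W i u g) (hUW : U ⊆ W) : IsWeakPartial U i u g := by
  refine ⟨h.1.mono_set hUW, h.2.1.mono_set hUW, fun φ hφ => ?_⟩
  have key : ∀ (k ψ : E N → ℝ), IsTestFunction U ψ →
      ∫ x in U, k x * ψ x = ∫ x in W, k x * ψ x := by
    intro k ψ hψ
    rw [setIntegral_eq_integral_of_forall_compl_eq_zero fun x hx => by rw [hψ.eq_zero hx, mul_zero],
      setIntegral_eq_integral_of_forall_compl_eq_zero fun x hx => by
        rw [hψ.eq_zero fun hxU => hx (hUW hxU), mul_zero]]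
  rw [key _ _ (hφ.partial_deriv i), key _ _ hφ]
  exact h.2.2 φ (hφ.of_subset hUW)

theorem IsWeakPartial.congr {U : Set (E N)} {i : Fin N} {u u' g : E N → ℝ}
    (h : IsWeakPartial U i u g) (hu : u =ᵐ[volume.restrict U] u')
    (hu' : LocallyIntegrableOn u' U volume) : IsWeakPartial U i u' g := by
  refine ⟨hu', h.2.1, fun φ hφ => ?_⟩
  rw [← h.2.2 φ hφ]
  refine integral_congr_ae ?_
  filter_upwards [hu] with x hx
  rw [hx]

theorem isWeakPartial_weakPartial {U : Set (E N)} {i : Fin N} {u g : E N → ℝ}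
    (h : IsWeakPartial U i u g) : IsWeakPartial U i u (weakPartial U i u) := by
  have hex : ∃ g, IsWeakPartial U i u g := ⟨g, h⟩
  rw [weakPartial, dif_pos hex]
  exact hex.choose_spec

theorem weakPartial_ae_eq {U : Set (E N)} (hU : IsOpen U) {i : Fin N} {u g : E N → ℝ}
    (h : IsWeakPartial U i u g) : weakPartial U i u =ᵐ[volume.restrict U] g :=
  (isWeakPartial_weakPartial h).ae_eq hU h

theorem normL2_congr {U : Set (E N)} {f g : E N → ℝ} (h : f =ᵐ[volume.restrict U] g) :
    normL2 U f = normL2 U g := by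
  unfold normL2
  rw [eLpNorm_congr_ae h]

theorem MemH.hasWeakGrad {u : E N → ℝ} (hu : MemH 1 univ u) :
    HasWeakGrad u fun i => weakPartial univ i u := by
  obtain ⟨h1, h2⟩ := hu
  rw [Measure.restrict_univ] at h1
  refine ⟨h1, fun i => ?_, fun i => ?_⟩ <;> obtain ⟨g, hg, hgm⟩ := h2 i
  · have hae := weakPartial_ae_eq isOpen_univ hg
    have hgm' : MemLp g 2 (volume.restrict univ) := hgm
    rw [Measure.restrict_univ] at hae hgm'
    exact hgm'.ae_eq hae.symm
  · exact isWeakPartial_weakPartial hg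

theorem normH_one_univ_sq (u : E N → ℝ) :
    normH 1 univ u ^ 2 = l2 u ^ 2 + ∑ i, l2 (weakPartial univ i u) ^ 2 := by
  rw [normH, Real.sq_sqrt]
  · simp only [normSqH, normL2_univ]
  · simp only [normSqH]
    positivity

theorem l2_le_normH (u : E N → ℝ) : l2 u ≤ normH 1 univ u := by
  refine le_of_sq_le_sq ?_ (Real.sqrt_nonneg _)
  rw [normH_one_univ_sq]
  exact le_add_of_nonneg_right (Finset.sum_nonneg fun i _ => sq_nonneg _)

theorem l2_weakPartial_le_normH (u : E N → ℝ) (i : Fin N) :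
    l2 (weakPartial univ i u) ≤ normH 1 univ u := by
  refine le_of_sq_le_sq ?_ (Real.sqrt_nonneg _)
  rw [normH_one_univ_sq]
  exact (Finset.single_le_sum (f := fun i => l2 (weakPartial univ i u) ^ 2)
    (fun j _ => sq_nonneg _) (Finset.mem_univ i)).trans (le_add_of_nonneg_left (sq_nonneg _))

theorem gradNorm_le_normH (u : E N → ℝ) :
    gradNorm u (fun i => weakPartial univ i u) ≤ (N + 1) * normH 1 univ u := by
  have h := Finset.sum_le_sum fun i (_ : i ∈ Finset.univ) => l2_weakPartial_le_normH u i
  rw [Finset.sum_const, Finset.card_univ, Fintype.card_fin, nsmul_eq_mul] at h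
  unfold gradNorm
  linarith [l2_le_normH u]

/-- A smooth cutoff function: compactly supported in `Ω` and equal to one on `K`. -/
theorem exists_isTestFunction_eq_one {Ω K : Set (E N)} (hΩ : IsOpen Ω) (hK : IsCompact K)
    (hKΩ : K ⊆ Ω) : ∃ η : E N → ℝ, IsTestFunction Ω η ∧ ∀ x ∈ K, η x = 1 := by
  obtain ⟨L, hL, hKL, hLΩ⟩ := exists_compact_between hK hΩ hKΩ
  obtain ⟨η, h1, h0, -⟩ := exists_contMDiffMap_one_nhds_of_subset_interior (n := ⊤)
    (modelWithCornersSelf ℝ (E N)) hK.isClosed hKL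
  have hsupp : tsupport η ⊆ L := closure_minimal
    (fun x hx => by_contra fun hxL => hx (h0 x hxL)) hL.isClosed
  exact ⟨η, ⟨η.contMDiff.contDiff, hL.of_isClosed_subset (isClosed_tsupport _) hsupp,
    hsupp.trans hLΩ⟩, fun x hx => h1.self_of_nhdsSet x hx⟩

theorem classicalPartial_eq_zero_of_eqOn_one {η : E N → ℝ} {V : Set (E N)} (hV : IsOpen V)
    (h : ∀ x ∈ V, η x = 1) (i : Fin N) {x : E N} (hx : x ∈ V) : classicalPartial i η x = 0 := by
  have : η =ᶠ[nhds x] fun _ => (1 : ℝ) := Filter.eventuallyEq_of_mem (hV.mem_nhds hx) h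
  unfold classicalPartial
  rw [this.fderiv_eq]
  simp

/-- The constant `c_{N,s}` is nonnegative. -/
theorem fracConst_nonneg (N : ℕ) [NeZero N] (s : ℝ) : 0 ≤ fracConst N s :=
  inv_nonneg.2 (integral_nonneg fun ζ =>
    div_nonneg (sub_nonneg.2 (Real.cos_le_one _)) (by positivity))

/-- The weak formulation in terms of `nonlocalForm`. -/
theorem IsWeakSolution.equation [NeZero N] {s : ℝ} (hs0 : 0 < s) (hs1 : s < 1) {Ω : Set (E N)}
    {f u : E N → ℝ} (hu : IsWeakSolution s Ω f u) {φ : E N → ℝ} (hφ : IsTestFunction Ω φ) :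
    (∑ i, ∫ x, weakPartial univ i u x * classicalPartial i φ x) +
      fracConst N s / 2 * nonlocalForm s u φ = ∫ x in Ω, f x * φ x := by
  have hg := hu.1.hasWeakGrad
  rw [← hu.2 φ hφ,
    integral_prod_eq_nonlocalForm hs0 hs1 hg (HasWeakGrad.of_test hφ.toUniv),
    setIntegral_eq_integral_of_forall_compl_eq_zero fun x hx => ?_, integral_finsetSum]
  · exact fun i _ => integrable_mul_of_memLp_two (hg.grad_memLp i) (hφ.partial_deriv i).memLp
  · exact Finset.sum_eq_zero fun i _ => by rw [(hφ.partial_deriv i).eq_zero hx, mul_zero]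

/-- From weak second derivatives on `V` to the `H²(V)` norm. -/
theorem memH_two_and_normH_le {V : Set (E N)} (hV : IsOpen V) {u : E N → ℝ} (hu : MemH 1 univ u)
    {G : Fin N → Fin N → E N → ℝ} {M : ℝ} (hM0 : 0 ≤ M)
    (hG : ∀ i j, IsWeakPartial V i (weakPartial univ j u) (G i j))
    (hGm : ∀ i j, MemLp (G i j) 2 volume) (hGM : ∀ i j, l2 (G i j) ≤ M) :
    MemH 2 V u ∧ normH 2 V u ≤ (N + 1) * normH 1 univ u + N * M := by
  have hg := hu.hasWeakGrad
  have hgV : ∀ j, IsWeakPartial V j u (weakPartial univ j u) := fun j =>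
    (hg.weak j).mono (subset_univ V)
  refine ⟨⟨hg.memLp.restrict V, fun j => ⟨_, hgV j, (hg.grad_memLp j).restrict V, fun i =>
    ⟨_, hG i j, (hGm i j).restrict V⟩⟩⟩, ?_⟩
  have e1 : ∀ j, normL2 V (weakPartial V j u) ≤ normH 1 univ u := fun j => by
    rw [normL2_congr (weakPartial_ae_eq hV (hgV j))]
    exact (normL2_le_l2 (hg.grad_memLp j) V).trans (l2_weakPartial_le_normH u j)
  have e2 : ∀ i j, normL2 V (weakPartial V i (weakPartial V j u)) ≤ M := fun i j => by
    have h : IsWeakPartial V i (weakPartial V j u) (G i j) :=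
      (hG i j).congr (weakPartial_ae_eq hV (hgV j)).symm (isWeakPartial_weakPartial (hgV j)).2.1
    rw [normL2_congr (weakPartial_ae_eq hV h)]
    exact (normL2_le_l2 (hGm i j) V).trans (hGM i j)
  have e0 : normL2 V u ≤ normH 1 univ u := (normL2_le_l2 hg.memLp V).trans (l2_le_normH u)
  have hX : 0 ≤ normH 1 univ u := Real.sqrt_nonneg _
  have hNR : (0 : ℝ) ≤ N := Nat.cast_nonneg N
  set X := normH 1 univ u
  have hsq : normSqH 2 V u ≤ X ^ 2 + N * (X ^ 2 + N * M ^ 2) := by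
    simp only [normSqH]
    refine add_le_add (pow_le_pow_left₀ (normL2_nonneg _ _) e0 2) ?_
    refine (Finset.sum_le_sum (g := fun _ => X ^ 2 + N * M ^ 2) fun j _ => ?_).trans
      (le_of_eq (by simp; ring))
    refine add_le_add (pow_le_pow_left₀ (normL2_nonneg _ _) (e1 j) 2) ?_
    refine (Finset.sum_le_sum (g := fun _ => M ^ 2) fun i _ => ?_).trans (le_of_eq (by simp))
    exact pow_le_pow_left₀ (normL2_nonneg _ _) (e2 i j) 2
  refine Real.sqrt_le_iff.2 ⟨by positivity, hsq.trans ?_⟩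
  have p1 : 0 ≤ N * X ^ 2 := by positivity
  have p2 : 0 ≤ (N : ℝ) ^ 2 * X ^ 2 := by positivity
  have p3 : 0 ≤ 2 * ((N : ℝ) + 1) * X * (N * M) := by positivity
  nlinarith

/-- Interior `H²` estimate on open sets with compact closure in `Ω`. -/
theorem exists_interior_estimate [NeZero N] {s : ℝ} (hs0 : 0 < s) (hs1 : s < 1) {Ω V : Set (E N)}
    (hΩ : IsOpen Ω) (hV : IsOpen V) (hVc : IsCompact (closure V)) (hVΩ : closure V ⊆ Ω) :
    ∃ Λ : ℝ, 0 < Λ ∧ ∀ f u : E N → ℝ, MemLp f 2 (volume.restrict Ω) → IsWeakSolution s Ω f u →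
      MemH 2 V u ∧ normH 2 V u ≤ Λ * (normL2 Ω f + normH 1 univ u) := by
  obtain ⟨η, hη, hη1⟩ := exists_isTestFunction_eq_one hΩ hVc hVΩ
  have hηV : ∀ x ∈ V, η x = 1 := fun x hx => hη1 x (subset_closure hx)
  have hc : 0 ≤ fracConst N s / 2 := div_nonneg (fracConst_nonneg N s) zero_le_two
  obtain ⟨C, hC0, hC⟩ := exists_localized_bound hs0 hs1 hc hη
  refine ⟨(N + 1) * (1 + N * C), by positivity, fun f u hf hu => ?_⟩
  have hg := hu.1.hasWeakGrad
  have hloc := hC f u _ hf hg fun φ hφ => hu.equation hs0 hs1 hφ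
  have hM0 : 0 ≤ C * (normL2 Ω f + gradNorm u fun i => weakPartial univ i u) :=
    mul_nonneg hC0 (add_nonneg (normL2_nonneg _ _) (gradNorm_nonneg _ _))
  choose G hG hGm hGM using exists_second_weakPartial (hg.test_mul hη.toUniv) hη.2.1.mul_right
    (fun j => hη.2.1.mul_right.add (hη.partial_deriv j).2.1.mul_right) hc hM0 hloc
  have hGV : ∀ i j, IsWeakPartial V i (weakPartial univ j u) (G i j) := fun i j => by
    refine ((hG i j).mono (subset_univ V)).congr ?_
      (((hg.grad_memLp j).locallyIntegrable (by norm_num)).locallyIntegrableOn V)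
    refine (ae_restrict_iff' hV.measurableSet).2 (Filter.Eventually.of_forall fun x hx => ?_)
    simp only [hηV x hx, classicalPartial_eq_zero_of_eqOn_one hV hηV j hx, one_mul, zero_mul,
      add_zero]
  obtain ⟨h1, h2⟩ := memH_two_and_normH_le hV hu.1 hM0 hGV hGm hGM
  refine ⟨h1, h2.trans ?_⟩
  have hX : 0 ≤ normH 1 univ u := Real.sqrt_nonneg _
  have hF : 0 ≤ normL2 Ω f := normL2_nonneg _ _
  have hN : (0 : ℝ) ≤ N := Nat.cast_nonneg N
  have h3 := mul_le_mul_of_nonneg_left (gradNorm_le_normH u) (mul_nonneg hN hC0)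
  have p1 : 0 ≤ (N : ℝ) * (N * C) * normL2 Ω f := by positivity
  have p2 : 0 ≤ ((N : ℝ) + 1) * normL2 Ω f := by positivity
  nlinarith

end MixedLaplacian

end

theorem theorem3p1 (N : ℕ) [NeZero N] (s : ℝ) (hs0 : 0 < s) (hs1 : s < 1)
    (Ω : Set (EuclideanSpace ℝ (Fin N))) (hΩ : IsOpen Ω) (hΩb : Bornology.IsBounded Ω) :
    (∀ f u : EuclideanSpace ℝ (Fin N) → ℝ,
      MemLp f 2 (volume.restrict Ω) → MixedLaplacian.IsWeakSolution s Ω f u →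
        MixedLaplacian.MemHloc 2 Ω u) ∧
    ∀ V : Set (EuclideanSpace ℝ (Fin N)), IsOpen V → closure V ⊆ Ω →
      ∃ Λ : ℝ, 0 < Λ ∧
        ∀ f u : EuclideanSpace ℝ (Fin N) → ℝ,
          MemLp f 2 (volume.restrict Ω) → MixedLaplacian.IsWeakSolution s Ω f u →
            MixedLaplacian.MemH 2 V u ∧
            MixedLaplacian.normH 2 V u ≤
              Λ * (MixedLaplacian.normL2 Ω f + MixedLaplacian.normH 1 univ u) := by
  refine ⟨fun f u hf hu V hV hVc hVΩ => ?_, fun V hV hVΩ => ?_⟩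
  · obtain ⟨Λ, -, h⟩ := MixedLaplacian.exists_interior_estimate hs0 hs1 hΩ hV hVc hVΩ
    exact (h f u hf hu).1
  · exact MixedLaplacian.exists_interior_estimate hs0 hs1 hΩ hV
      (Metric.isCompact_of_isClosed_isBounded isClosed_closure (hΩb.subset hVΩ)) hVΩ
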